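/- **Setting.** Let $n\ge 1$, let $\Omega\subset\mathbb R^n$ be a bounded domain (open, connected, non-empty), $p>2$, and let $f\in C^1(\overline\Omega)$ (that is, $f\in C^1(\Omega)$, and $f$ and $Df$ extend continuously to $\overline\Omega$) with $0<\inf_\Omega f\le\sup_\Omega f<\infty$. Let $F$ be a real continuous function on a neighbourhood of $\partial\Omega$. Consider the problem $$-\Delta_{p,f}u:=-\operatorname{div}\bigl(f|Du|^{p-2}Du\bigr)=0\ \text{ in }\Omega\quad(P),\qquad u=F\ \text{ on }\partial\Omega\quad(F).$$ **Game.** Put $\alpha=\frac{p-2}{p+n}$, $\beta=1-\alpha$, $\gamma(x)=\dfrac{f(x)}{\frac{|Df(x)|}{2(p+n)}+f(x)}$ for $x\in\Omega$ (so $\gamma(x)=1$ if $Df(x)=0$), and, for $\epsilon>0$, $\Gamma_\epsilon=\{y\in\mathbb R^n\setminus\Omega:\operatorname{dist}(y,\Omega)\le\epsilon\}$; $B_\epsilon(x)$ is the open ball. A strategy of a player assigns to each history $(x_0,\dots,x_k)$, in a Borel measurable way, a point of $B_\epsilon(x_k)$. Given strategies $S_A,S_B$ and a starting point $x_0\in\Omega\cup\Gamma_\epsilon$,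 a token at $x_k\in\Omega$ moves, with probability $\frac{\gamma(x_k)\alpha}{2}$ each, to $S_A(x_0,\dots,x_k)$ or to $S_B(x_0,\dots,x_k)$; with probability $\gamma(x_k)\beta$ to a uniformly distributed point of $B_\epsilon(x_k)$; and with probability $1-\gamma(x_k)$ to $x_k+\epsilon^2\frac{Df(x_k)}{|Df(x_k)|}$. The game stops at the first time $\tau$ with $x_\tau\in\Gamma_\epsilon$. Let $\mathbb E^{x_0}_{S_A,S_B}$ be the expectation under the induced law of the token, and let $$u_\epsilon(x_0)=\sup_{S_A}\inf_{S_B}\mathbb E^{x_0}_{S_A,S_B}[F(x_\tau)].$$ (Only small $\epsilon$ matter below; for those $\Gamma_\epsilon$ lies in the domain of $F$.) For $x\in\overline\Omega$ set $$\overline u(x)=\lim_{\nu\to0+}\sup\{u_\epsilon(y):y\in\overline\Omega,\ \epsilon>0,\ |y-x|+\epsilon\le\nu\},\qquad \underline u(x)=\lim_{\nu\to0+}\inf\{u_\epsilon(y):y\in\overline\Omega,\ \epsilon>0,\ |y-x|+\epsilon\le\nu\}.$$ **Generalized solutions.** An upper (resp. lower) semicontinuous $u:\overline\Omega\to\mathbb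 R$ is a generalized viscosity subsolution (resp. supersolution) of $(P)(F)$ if, whenever $x_0\in\overline\Omega$ and $\phi$ is a function of class $C^2$ in a neighbourhood of $\overline\Omega$ with $\phi(x_0)=u(x_0)$ and $\phi(x)>u(x)$ (resp. $\phi(x)<u(x)$) for all $x\in\overline\Omega\setminus\{x_0\}$, one has $$-\Delta_{p,f}\phi(x_0)\le0\quad(\text{resp. }\ge0)\qquad\text{if }x_0\in\Omega,$$ $$\min\{-\Delta_{p,f}\phi(x_0),\,u(x_0)-F(x_0)\}\le0\quad\bigl(\text{resp. }\max\{-\Delta_{p,f}\phi(x_0),\,u(x_0)-F(x_0)\}\ge0\bigr)\qquad\text{if }x_0\in\partial\Omega,$$ where for $x_0\in\partial\Omega$ the number $\Delta_{p,f}\phi(x_0)$ is formed with the continuous extensions of $f$ and $Df$, i.e. it is $\lim_{\Omega\ni x\to x_0}\Delta_{p,f}\phi(x)$. **Theorem.** For all sufficiently small $\epsilon>0$ the game is well posed: for all strategies and all starting points in $\Omega\cup\Gamma_\epsilon$, $\tau<\infty$ almost surely and $F(x_\tau)$ is integrable. The half-relaxed limits $\overline u,\underline u$ exist and are real-valued on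 $\overline\Omega$; $\overline u$ is a generalized viscosity subsolution and $\underline u$ is a generalized viscosity supersolution of $(P)(F)$. -/

import Mathlib

open MeasureTheory ProbabilityTheory Filter Topology

/-- The Euclidean space of dimension `n`. -/
abbrev Eucl (n : ℕ) : Type := EuclideanSpace ℝ (Fin n)

/-- The data of the Dirichlet problem `- div (f |Du|^(p-2) Du) = 0` in `Ω`, `u = F` on `∂Ω`,
with the standing assumptions on them. The functions `f` and `F` are total for convenience: only
the values of `f` on `Ω` (and their limits at the boundary) and those of `F` near `∂Ω` matter. -/
structure WeightedDirichletProblem (n : ℕ) where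
  /-- the domain -/
  Ω : Set (Eucl n)
  /-- the exponent -/
  p : ℝ
  /-- the weight -/
  f : Eucl n → ℝ
  /-- the boundary function, defined and continuous near `∂Ω` -/
  F : Eucl n → ℝ
  dim_pos : 0 < n
  isOpen : IsOpen Ω
  isConnected : IsConnected Ω
  isBounded : Bornology.IsBounded Ω
  two_lt_p : 2 < p
  f_contDiffOn : ContDiffOn ℝ 1 f Ω
  /-- the weight is continuous up to the boundary -/
  f_continuousOn_closure : ContinuousOn f (closure Ω)
  /-- the gradient of the weight extends continuously up to the boundary -/
  gradient_f_extends :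
    ∃ g : Eucl n → Eucl n, ContinuousOn g (closure Ω) ∧ ∀ x ∈ Ω, g x = gradient f x
  f_bounds : ∃ c C : ℝ, 0 < c ∧ ∀ x ∈ Ω, c ≤ f x ∧ f x ≤ C
  F_continuous_near_boundary :
    ∃ V : Set (Eucl n), IsOpen V ∧ frontier Ω ⊆ V ∧ ContinuousOn F V

/-- A pure strategy with step size `ε`: to each history `(x_0, …, x_k)` it assigns, in a Borel
measurable way, a point of the open ball `B_ε(x_k)`. -/
structure Strategy (n : ℕ) (ε : ℝ) where
  move : (k : ℕ) → ((i : Finset.Iic k) → Eucl n) → Eucl n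
  measurable_move : ∀ k, Measurable (move k)
  move_mem : ∀ k h, move k h ∈ Metric.ball (h ⟨k, Finset.mem_Iic.2 le_rfl⟩) ε

namespace WeightedDirichletProblem

noncomputable section

variable {n : ℕ} (G : WeightedDirichletProblem n)

/-! The game. -/

/-- The probability `α = (p - 2) / (p + n)`. -/
def alpha : ℝ := (G.p - 2) / (G.p + n)

/-- The probability `β = 1 - α`. -/
def beta : ℝ := 1 - G.alpha

/-- The function `γ = f / (|Df| / (2 (p + n)) + f)`; only its values on `Ω` are used. -/
def gamma (x : Eucl n) : ℝ :=
  G.f x / (‖gradient G.f x‖ / (2 * (G.p + n)) + G.f x)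

/-- The exterior neighbourhood `Γ_ε = {y ∉ Ω | dist (y, Ω) ≤ ε}`. -/
def outerStrip (ε : ℝ) : Set (Eucl n) := {y | y ∉ G.Ω ∧ Metric.infDist y G.Ω ≤ ε}

/-- The uniform probability distribution on the open ball `B_ε(x)`. -/
def uniformBall (ε : ℝ) (x : Eucl n) : Measure (Eucl n) :=
  (volume (Metric.ball x ε))⁻¹ • volume.restrict (Metric.ball x ε)

/-- The law of the next position when the token is at `x ∈ Ω` and the players choose `a` and `b`:
with probability `γ β` a uniform random point of `B_ε(x)`, with probability `γ α / 2` each the point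
`a` or `b`, and with probability `1 - γ` (which is zero where `Df = 0`) the
point `x + ε² Df / |Df|`. -/
def stepLaw (ε : ℝ) (x a b : Eucl n) : Measure (Eucl n) :=
  ENNReal.ofReal (G.gamma x * G.beta) • uniformBall ε x
    + ENNReal.ofReal (G.gamma x * (G.alpha / 2)) • Measure.dirac a
    + ENNReal.ofReal (G.gamma x * (G.alpha / 2)) • Measure.dirac b
    + open Classical in if gradient G.f x = 0 then 0 else
        ENNReal.ofReal (1 - G.gamma x) •
          Measure.dirac (x + (ε ^ 2 / ‖gradient G.f x‖) • gradient G.f x)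

/-- The transition law given the current position `x` and the two choices; once the token has left
`Ω` the game is over and the token stays where it is. -/
def nextLaw (ε : ℝ) (x a b : Eucl n) : Measure (Eucl n) :=
  open Classical in if x ∈ G.Ω then G.stepLaw ε x a b else Measure.dirac x

/-! Facts needed to see that the transition laws form Markov kernels. -/

lemma measurable_gradient_f : Measurable (gradient G.f) := by
  unfold gradient
  exact (LinearIsometryEquiv.continuous _).measurable.comp (measurable_fderiv ℝ G.f)

lemma measurable_indicator_gamma : Measurable (G.Ω.indicator G.gamma) := by
  have hm := G.isOpen.measurableSet
  have hf : Measurable (G.Ω.indicator G.f) := by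
    classical
    rw [← Set.piecewise_eq_indicator]
    exact G.f_contDiffOn.continuousOn.measurable_piecewise continuous_zero.continuousOn hm
  have hg := G.measurable_gradient_f
  have key : G.Ω.indicator G.gamma = G.Ω.indicator (fun x => G.Ω.indicator G.f x /
      (‖gradient G.f x‖ / (2 * (G.p + n)) + G.Ω.indicator G.f x)) := by
    ext x
    by_cases hx : x ∈ G.Ω <;> simp [hx, gamma]
  rw [key]
  exact (hf.div ((hg.norm.div_const _).add hf)).indicator hm

lemma p_add_pos : 0 < G.p + n := by
  have := G.two_lt_p
  positivity

lemma alpha_nonneg : 0 ≤ G.alpha :=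
  div_nonneg (by linarith [G.two_lt_p]) G.p_add_pos.le

lemma beta_nonneg : 0 ≤ G.beta := by
  have h : G.alpha ≤ 1 := (div_le_one G.p_add_pos).2 (by
    have : (0 : ℝ) ≤ n := n.cast_nonneg
    linarith)
  simpa [beta] using h

lemma f_pos {x : Eucl n} (hx : x ∈ G.Ω) : 0 < G.f x := by
  obtain ⟨c, C, hc, h⟩ := G.f_bounds
  exact hc.trans_le (h x hx).1

lemma gamma_nonneg {x : Eucl n} (hx : x ∈ G.Ω) : 0 ≤ G.gamma x := by
  have h1 := G.f_pos hx
  have h2 := G.p_add_pos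
  unfold gamma
  positivity

lemma gamma_le_one {x : Eucl n} (hx : x ∈ G.Ω) : G.gamma x ≤ 1 := by
  have h1 := G.f_pos hx
  have h2 := G.p_add_pos
  unfold gamma
  rw [div_le_one (by positivity)]
  have : 0 ≤ ‖gradient G.f x‖ / (2 * (G.p + n)) := by positivity
  linarith

lemma gamma_eq_one {x : Eucl n} (hx : x ∈ G.Ω) (h : gradient G.f x = 0) : G.gamma x = 1 := by
  simp [gamma, h, (G.f_pos hx).ne']

lemma measurable_uniformBall (ε : ℝ) : Measurable (uniformBall (n := n) ε) := by
  refine Measure.measurable_of_measurable_coe _ fun A hA => ?_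
  have h : ∀ B : Set (Eucl n), MeasurableSet B →
      Measurable fun x : Eucl n => volume (B ∩ Metric.ball x ε) := by
    intro B hB
    have hs : MeasurableSet {q : Eucl n × Eucl n | q.2 ∈ B ∧ dist q.2 q.1 < ε} :=
      (measurable_snd hB).inter
        (isOpen_lt (continuous_snd.dist continuous_fst) continuous_const).measurableSet
    exact measurable_measure_prodMk_left hs
  have h1 := h Set.univ MeasurableSet.univ
  simp only [Set.univ_inter] at h1
  simp only [uniformBall, Measure.smul_apply, smul_eq_mul, Measure.restrict_apply hA]
  exact h1.inv.mul (h A hA)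

lemma uniformBall_univ {ε : ℝ} (hε : 0 < ε) (x : Eucl n) : uniformBall ε x Set.univ = 1 := by
  simp only [uniformBall, Measure.smul_apply, smul_eq_mul, Measure.restrict_apply_univ]
  exact ENNReal.inv_mul_cancel (Metric.measure_ball_pos volume x hε).ne' measure_ball_lt_top.ne

lemma nextLaw_univ {ε : ℝ} (hε : 0 < ε) (x a b : Eucl n) :
    G.nextLaw ε x a b Set.univ = 1 := by
  unfold nextLaw
  split_ifs with hx
  · have hα := G.alpha_nonneg
    have hβ := G.beta_nonneg
    have hγ := G.gamma_nonneg hx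
    have hγ' := sub_nonneg.2 (G.gamma_le_one hx)
    have hz : (open Classical in if gradient G.f x = 0 then (0 : Measure (Eucl n)) else
        ENNReal.ofReal (1 - G.gamma x) •
          Measure.dirac (x + (ε ^ 2 / ‖gradient G.f x‖) • gradient G.f x)) Set.univ
        = ENNReal.ofReal (1 - G.gamma x) := by
      split_ifs with h0
      · simp [G.gamma_eq_one hx h0]
      · simp
    simp only [stepLaw, Measure.add_apply, hz, Measure.smul_apply, smul_eq_mul,
      uniformBall_univ hε, measure_univ, mul_one]
    rw [← ENNReal.ofReal_add (by positivity) (by positivity),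
      ← ENNReal.ofReal_add (by positivity) (by positivity),
      ← ENNReal.ofReal_add (by positivity) hγ', ENNReal.ofReal_eq_one, beta]
    ring
  · simp

lemma measurable_nextLaw (ε : ℝ) :
    Measurable fun q : Eucl n × Eucl n × Eucl n => G.nextLaw ε q.1 q.2.1 q.2.2 := by
  classical
  have hm : MeasurableSet {q : Eucl n × Eucl n × Eucl n | q.1 ∈ G.Ω} :=
    measurable_fst G.isOpen.measurableSet
  have hg : Measurable fun q : Eucl n × Eucl n × Eucl n => gradient G.f q.1 :=
    G.measurable_gradient_f.comp measurable_fst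
  have hγ : Measurable fun q : Eucl n × Eucl n × Eucl n => G.Ω.indicator G.gamma q.1 :=
    G.measurable_indicator_gamma.comp measurable_fst
  have hz : MeasurableSet {q : Eucl n × Eucl n × Eucl n | gradient G.f q.1 = 0} :=
    hg (measurableSet_singleton 0)
  have hu : Measurable fun q : Eucl n × Eucl n × Eucl n => uniformBall ε q.1 :=
    (measurable_uniformBall ε).comp measurable_fst
  have hd : Measurable fun q : Eucl n × Eucl n × Eucl n =>
      Measure.dirac (q.1 + (ε ^ 2 / ‖gradient G.f q.1‖) • gradient G.f q.1) :=
    Measure.measurable_dirac.comp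
      (measurable_fst.add ((measurable_const.div hg.norm).smul hg))
  have key : (fun q : Eucl n × Eucl n × Eucl n => G.nextLaw ε q.1 q.2.1 q.2.2) =
      fun q => if q.1 ∈ G.Ω then
        ENNReal.ofReal (G.Ω.indicator G.gamma q.1 * G.beta) • uniformBall ε q.1
        + ENNReal.ofReal (G.Ω.indicator G.gamma q.1 * (G.alpha / 2)) • Measure.dirac q.2.1
        + ENNReal.ofReal (G.Ω.indicator G.gamma q.1 * (G.alpha / 2)) • Measure.dirac q.2.2
        + (if gradient G.f q.1 = 0 then 0 else
          ENNReal.ofReal (1 - G.Ω.indicator G.gamma q.1) •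
            Measure.dirac (q.1 + (ε ^ 2 / ‖gradient G.f q.1‖) • gradient G.f q.1))
        else Measure.dirac q.1 := by
    ext1 q
    by_cases hx : q.1 ∈ G.Ω <;> simp [nextLaw, stepLaw, hx]
  rw [key]
  refine Measure.measurable_of_measurable_coe _ fun A hA => ?_
  have ev : ∀ {g : Eucl n × Eucl n × Eucl n → Measure (Eucl n)}, Measurable g →
      Measurable fun q => g q A := fun h => (Measure.measurable_coe hA).comp h
  have h1 := ev hu
  have h2 := ev (Measure.measurable_dirac.comp (measurable_fst.comp measurable_snd) :
    Measurable fun q : Eucl n × Eucl n × Eucl n => Measure.dirac q.2.1)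
  have h3 := ev (Measure.measurable_dirac.comp (measurable_snd.comp measurable_snd) :
    Measurable fun q : Eucl n × Eucl n × Eucl n => Measure.dirac q.2.2)
  have h4 := ev hd
  have h5 := ev (Measure.measurable_dirac.comp measurable_fst :
    Measurable fun q : Eucl n × Eucl n × Eucl n => Measure.dirac q.1)
  simp only [apply_ite (fun μ : Measure (Eucl n) => μ A), Measure.add_apply, Measure.smul_apply,
    smul_eq_mul, Measure.coe_zero, Pi.zero_apply]
  refine Measurable.ite hm ?_ h5
  refine (((hγ.mul_const _).ennreal_ofReal.mul h1).add
    ((hγ.mul_const _).ennreal_ofReal.mul h2)).add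
    ((hγ.mul_const _).ennreal_ofReal.mul h3) |>.add ?_
  exact Measurable.ite hz measurable_const ((measurable_const.sub hγ).ennreal_ofReal.mul h4)

/-- The transition kernel of the game from histories `(x_0, …, x_k)` to the next position, when the
players use the strategies `SA` and `SB`. -/
def transition {ε : ℝ} (SA SB : Strategy n ε) (k : ℕ) :
    Kernel ((i : Finset.Iic k) → Eucl n) (Eucl n) where
  toFun h := G.nextLaw ε (h ⟨k, Finset.mem_Iic.2 le_rfl⟩) (SA.move k h) (SB.move k h)
  measurable' := by
    have h : Measurable fun h : (i : Finset.Iic k) → Eucl n =>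
        (h ⟨k, Finset.mem_Iic.2 le_rfl⟩, SA.move k h, SB.move k h) :=
      (measurable_pi_apply _).prodMk ((SA.measurable_move k).prodMk (SB.measurable_move k))
    exact (G.measurable_nextLaw ε).comp h

lemma isMarkovKernel_transition {ε : ℝ} (hε : 0 < ε) (SA SB : Strategy n ε) (k : ℕ) :
    IsMarkovKernel (G.transition SA SB k) :=
  ⟨fun _ => ⟨G.nextLaw_univ hε _ _ _⟩⟩

/-- The law of the sequence `(x_0, x_1, …)` of positions of the token started at `x₀`
(Ionescu-Tulcea construction from the transition kernels). -/
def gameLaw {ε : ℝ} (hε : 0 < ε) (SA SB : Strategy n ε) (x₀ : Eucl n) :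
    Measure (ℕ → Eucl n) :=
  haveI := G.isMarkovKernel_transition hε SA SB
  Kernel.traj (X := fun _ => Eucl n) (G.transition SA SB) 0 (fun _ => x₀)

/-- The first time at which the token is in `Γ_ε` (a dummy value if this never happens). -/
def exitTime (ε : ℝ) (ω : ℕ → Eucl n) : ℕ := sInf {k | ω k ∈ G.outerStrip ε}

/-- The payoff `F (x_τ)`. -/
def payoff (ε : ℝ) (ω : ℕ → Eucl n) : ℝ := G.F (ω (G.exitTime ε ω))

/-- The game with step size `ε` is well posed: from any starting point and for any strategies, the
token almost surely reaches `Γ_ε`, and the payoff is integrable. -/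
def IsWellPosed {ε : ℝ} (hε : 0 < ε) : Prop :=
  ∀ (SA SB : Strategy n ε), ∀ x₀ ∈ G.Ω ∪ G.outerStrip ε,
    (∀ᵐ ω ∂(G.gameLaw hε SA SB x₀), ∃ k, ω k ∈ G.outerStrip ε) ∧
    Integrable (G.payoff ε) (G.gameLaw hε SA SB x₀)

/-- The value function `u_ε (x₀) = sup_{SA} inf_{SB} E[F (x_τ)]` of the game. -/
def value {ε : ℝ} (hε : 0 < ε) (x₀ : Eucl n) : EReal :=
  ⨆ SA : Strategy n ε, ⨅ SB : Strategy n ε,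
    ((∫ ω, G.payoff ε ω ∂(G.gameLaw hε SA SB x₀) : ℝ) : EReal)

/-! Half-relaxed limits. -/

/-- The values `u_ε (y)` with `ε > 0`, `y ∈ closure Ω` and `|y - x| + ε ≤ ν`. -/
def nearbyValues (x : Eucl n) (ν : ℝ) : Set EReal :=
  {t | ∃ (ε : ℝ) (hε : 0 < ε) (y : Eucl n), y ∈ closure G.Ω ∧ dist y x + ε ≤ ν ∧
    t = G.value hε y}

/-- `w` is (real-valued and) the upper half-relaxed limit of `u_ε` on `closure Ω`. -/
def IsUpperHalfRelaxedLimit (w : Eucl n → ℝ) : Prop :=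
  ∀ x ∈ closure G.Ω,
    Tendsto (fun ν : ℝ => sSup (G.nearbyValues x ν)) (𝓝[>] 0) (𝓝 (w x : EReal))

/-- `w` is (real-valued and) the lower half-relaxed limit of `u_ε` on `closure Ω`. -/
def IsLowerHalfRelaxedLimit (w : Eucl n → ℝ) : Prop :=
  ∀ x ∈ closure G.Ω,
    Tendsto (fun ν : ℝ => sInf (G.nearbyValues x ν)) (𝓝[>] 0) (𝓝 (w x : EReal))

/-! Generalized viscosity solutions. -/

/-- The divergence of a vector field. -/
def divergence (V : Eucl n → Eucl n) (x : Eucl n) : ℝ :=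
  ∑ i : Fin n, (fderiv ℝ V x (EuclideanSpace.single i 1)) i

/-- The weighted `p`-Laplacian `div (f |Dφ|^(p-2) Dφ)` at points of `Ω`. -/
def weightedPLaplacian (φ : Eucl n → ℝ) (x : Eucl n) : ℝ :=
  divergence (fun y => (G.f y * ‖gradient φ y‖ ^ (G.p - 2)) • gradient φ y) x

/-- The weighted `p`-Laplacian of `φ` at a boundary point, where `f` and `Df` are understood as the
limits of their values in `Ω`: it is the limit of the weighted `p`-Laplacian from inside `Ω`. -/
def weightedPLaplacianBoundary (φ : Eucl n → ℝ) (x : Eucl n) : ℝ :=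
  extendFrom G.Ω (G.weightedPLaplacian φ) x

/-- Test functions: `φ ∈ C²(closure Ω)`, that is, `φ` is `C²` in a neighbourhood of
`closure Ω`. -/
def IsTestFunction (φ : Eucl n → ℝ) : Prop :=
  ∃ U : Set (Eucl n), IsOpen U ∧ closure G.Ω ⊆ U ∧ ContDiffOn ℝ 2 φ U

/-- Generalized viscosity subsolutions of the Dirichlet problem. -/
def IsGeneralizedSubsolution (u : Eucl n → ℝ) : Prop :=
  UpperSemicontinuousOn u (closure G.Ω) ∧
  ∀ φ : Eucl n → ℝ, G.IsTestFunction φ → ∀ x₀ ∈ closure G.Ω, φ x₀ = u x₀ →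
    (∀ x ∈ closure G.Ω, x ≠ x₀ → u x < φ x) →
    (x₀ ∈ G.Ω → - G.weightedPLaplacian φ x₀ ≤ 0) ∧
    (x₀ ∈ frontier G.Ω →
      min (- G.weightedPLaplacianBoundary φ x₀) (u x₀ - G.F x₀) ≤ 0)

/-- Generalized viscosity supersolutions of the Dirichlet problem. -/
def IsGeneralizedSupersolution (u : Eucl n → ℝ) : Prop :=
  LowerSemicontinuousOn u (closure G.Ω) ∧
  ∀ φ : Eucl n → ℝ, G.IsTestFunction φ → ∀ x₀ ∈ closure G.Ω, φ x₀ = u x₀ →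
    (∀ x ∈ closure G.Ω, x ≠ x₀ → φ x < u x) →
    (x₀ ∈ G.Ω → 0 ≤ - G.weightedPLaplacian φ x₀) ∧
    (x₀ ∈ frontier G.Ω →
      0 ≤ max (- G.weightedPLaplacianBoundary φ x₀) (u x₀ - G.F x₀))

end

end WeightedDirichletProblem

/-! The values of the game are identified with solutions of the dynamic programming principle, and
the differential inequality is read off from one step of that principle.

For fixed small `ε`, `dppMean` averages the supremum and infimum over the ball, the mean over the
ball, and the value at the drift point. The noise has probability bounded below on `Ω`
(`exists_gamma_ge`), so a steep exponential of one coordinate at least doubles in mean at each step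
taken from `Ω` (`exists_two_mul_expCoord_le`). This one barrier is used twice. It makes value
iteration contract in a weighted norm, which gives a bounded Borel fixed point
(`exists_isDPPSolution`). It also makes a bounded quantity grow linearly in mean unless the token
leaves `Ω`, which gives termination (`ae_exists_mem_outerStrip`). Almost optimal Borel selections
(`exists_measurable_almost_max`) turn the fixed point into almost optimal Markovian strategies, so
the fixed point is the value (`IsDPPSolution.value_eq`).

If a solution lies below a quadratic polynomial near `x`, the first-order terms of supremum and
infimum cancel, the noise yields the Laplacian, the players the second derivative along the
gradient, and the drift the term with `Df`. The weights `α`, `β`, `γ` are tuned so that these add up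
to a positive multiple of the operator divided by `|Dφ|^(p-2)` (`IsDPPSolution.le_of_le_quadratic`).
At an almost maximum of value minus test function, a strictly negative operator contradicts this
expansion (`IsValueFamily.normalizedPOperator_nonneg`). Where `Dφ = 0`, the unnormalized operator
vanishes because `p > 2`, so nothing has to be proved. The lower limit follows by changing the sign
of `F`, since the game has a value. -/

namespace WeightedDirichletProblem

noncomputable section

variable {n : ℕ} (G : WeightedDirichletProblem n)

/-! ### Geometry of the exterior strip and the mean after one step -/

/-- The region in which the token lives: the domain together with its exterior strip. -/
def region (ε : ℝ) : Set (Eucl n) := G.Ω ∪ G.outerStrip ε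

/-- The deterministic drift move. -/
def shift (ε : ℝ) (x : Eucl n) : Eucl n := x + (ε ^ 2 / ‖gradient G.f x‖) • gradient G.f x

lemma beta_pos : 0 < G.beta := by
  have h := G.p_add_pos
  have : G.beta = (n + 2) / (G.p + n) := by
    unfold beta alpha
    field_simp
    ring
  rw [this]
  positivity

/-- A bounded set is not the whole space in positive dimension, and a nonempty proper subset of a
connected space has a frontier. -/
lemma frontier_nonempty : (frontier G.Ω).Nonempty := by
  have hne := G.isConnected.nonempty
  have : Nonempty (Fin n) := ⟨⟨0, G.dim_pos⟩⟩
  refine nonempty_frontier_iff.2 ⟨hne, fun h => ?_⟩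
  have := G.isBounded
  rw [h] at this
  exact NormedSpace.unbounded_univ ℝ (Eucl n) this

lemma isCompact_closure : IsCompact (closure G.Ω) := G.isBounded.isCompact_closure

lemma isCompact_frontier : IsCompact (frontier G.Ω) :=
  G.isCompact_closure.of_isClosed_subset isClosed_frontier frontier_subset_closure

lemma measurableSet_outerStrip (ε : ℝ) : MeasurableSet (G.outerStrip ε) :=
  G.isOpen.measurableSet.compl.inter
    (isClosed_le (Metric.continuous_infDist_pt _) continuous_const).measurableSet

lemma measurableSet_region (ε : ℝ) : MeasurableSet (G.region ε) :=
  G.isOpen.measurableSet.union (G.measurableSet_outerStrip ε)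

lemma mem_region_of_dist_le {ε : ℝ} {x y : Eucl n} (hx : x ∈ G.Ω) (h : dist y x ≤ ε) :
    y ∈ G.region ε := by
  by_cases hy : y ∈ G.Ω
  · exact Or.inl hy
  · exact Or.inr ⟨hy, (Metric.infDist_le_dist_of_mem hx).trans h⟩

lemma closure_subset_region {ε : ℝ} (hε : 0 < ε) : closure G.Ω ⊆ G.region ε := by
  intro x hx
  by_cases hx' : x ∈ G.Ω
  · exact Or.inl hx'
  · exact Or.inr ⟨hx', by
      rw [(Metric.mem_closure_iff_infDist_zero G.isConnected.nonempty).1 hx]; exact hε.le⟩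

lemma frontier_subset_outerStrip {ε : ℝ} (hε : 0 < ε) : frontier G.Ω ⊆ G.outerStrip ε := by
  intro x hx
  rcases G.closure_subset_region hε (frontier_subset_closure hx) with h | h
  · exact absurd h (by rw [G.isOpen.frontier_eq] at hx; exact hx.2)
  · exact h

/-- The segment from a point outside `Ω` to its nearest point in the closure is connected, so it
meets the frontier at a point no farther away. This matters because `F` is controlled only near the
frontier. -/
lemma outerStrip_subset_cthickening (ε : ℝ) :
    G.outerStrip ε ⊆ Metric.cthickening ε (frontier G.Ω) := by
  rintro y ⟨hy, hd⟩
  obtain ⟨z, hz, hdz⟩ := G.isCompact_closure.exists_infDist_eq_dist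
    G.isConnected.nonempty.closure y
  rw [Metric.infDist_closure] at hdz
  have hseg : ∃ w ∈ segment ℝ y z, w ∈ frontier G.Ω := by
    by_cases hz' : z ∈ G.Ω
    · have hc : IsPreconnected (segment ℝ y z) := (convex_segment y z).isPreconnected
      by_cases hyc : y ∈ closure G.Ω
      · exact ⟨y, left_mem_segment ℝ y z, by rw [G.isOpen.frontier_eq]; exact ⟨hyc, hy⟩⟩
      by_contra! hno
      obtain ⟨w, -, hw1, hw2⟩ := hc G.Ω (closure G.Ω)ᶜ G.isOpen isClosed_closure.isOpen_compl
        (fun w hw => by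
          by_contra hcon
          simp only [Set.mem_union, Set.mem_compl_iff, not_or, not_not] at hcon
          exact hno w hw (by rw [G.isOpen.frontier_eq]; exact ⟨hcon.2, hcon.1⟩))
        ⟨z, right_mem_segment ℝ y z, hz'⟩ ⟨y, left_mem_segment ℝ y z, hyc⟩
      exact hw2 (subset_closure hw1)
    · exact ⟨z, right_mem_segment ℝ y z, by rw [G.isOpen.frontier_eq]; exact ⟨hz, hz'⟩⟩
  obtain ⟨w, hw, hwf⟩ := hseg
  refine Metric.mem_cthickening_of_dist_le y w ε _ hwf ?_
  have h1 : dist y w + dist w z = dist y z := dist_add_dist_of_mem_segment hw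
  have := dist_nonneg (x := w) (y := z)
  linarith

lemma exists_outerStrip_subset {V : Set (Eucl n)} (hV : IsOpen V) (h : frontier G.Ω ⊆ V) :
    ∃ δ > 0, Metric.cthickening δ (frontier G.Ω) ⊆ V ∧ ∀ ε ≤ δ, G.outerStrip ε ⊆
      Metric.cthickening δ (frontier G.Ω) := by
  obtain ⟨δ, hδ, hs⟩ := G.isCompact_frontier.exists_cthickening_subset_open hV h
  exact ⟨δ, hδ, hs, fun ε hε => (G.outerStrip_subset_cthickening ε).trans
    (Metric.cthickening_mono hε _)⟩

lemma dist_shift_le {ε : ℝ} (x : Eucl n) : dist (G.shift ε x) x ≤ ε ^ 2 := by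
  rw [shift, dist_eq_norm, add_sub_cancel_left, norm_smul, norm_div, norm_norm,
    Real.norm_of_nonneg (sq_nonneg ε)]
  rcases eq_or_ne ‖gradient G.f x‖ 0 with h | h
  · rw [h]; simpa using sq_nonneg ε
  · rw [div_mul_cancel₀ _ h]

lemma measurable_shift (ε : ℝ) : Measurable (G.shift ε) :=
  measurable_id.add ((measurable_const.div G.measurable_gradient_f.norm).smul
    G.measurable_gradient_f)

lemma exists_norm_gradient_le : ∃ D : ℝ, 0 ≤ D ∧ ∀ x ∈ G.Ω, ‖gradient G.f x‖ ≤ D := by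
  obtain ⟨g, hg, hgf⟩ := G.gradient_f_extends
  obtain ⟨D, hD⟩ := G.isCompact_closure.exists_bound_of_continuousOn hg
  obtain ⟨x, hx⟩ := G.isConnected.nonempty
  refine ⟨D, (norm_nonneg _).trans (hD x (subset_closure hx)), fun x hx => ?_⟩
  rw [← hgf x hx]
  exact hD x (subset_closure hx)

/-- The gradient of `f` is bounded because it extends continuously to the compact closure. Thus the
drift never takes all the probability, and the noise retains a uniform share. -/
lemma exists_gamma_ge : ∃ c : ℝ, 0 < c ∧ ∀ x ∈ G.Ω, c ≤ G.gamma x := by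
  obtain ⟨D, hD, hgD⟩ := G.exists_norm_gradient_le
  obtain ⟨c, C, hc, hf⟩ := G.f_bounds
  have hp := G.p_add_pos
  obtain ⟨x, hx⟩ := G.isConnected.nonempty
  have hC : 0 < C := hc.trans_le ((hf x hx).1.trans (hf x hx).2)
  refine ⟨c / (D / (2 * (G.p + n)) + C), by positivity, fun x hx => ?_⟩
  have h0 := G.f_pos hx
  unfold gamma
  have := hgD x hx
  gcongr
  · exact (hf x hx).1
  · exact (hf x hx).2

instance isProbabilityMeasure_uniformBall {ε : ℝ} [hε : Fact (0 < ε)] (x : Eucl n) :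
    IsProbabilityMeasure (uniformBall ε x) := ⟨uniformBall_univ hε.out x⟩

lemma ae_uniformBall (ε : ℝ) (x : Eucl n) : ∀ᵐ y ∂(uniformBall ε x), y ∈ Metric.ball x ε :=
  Measure.ae_smul_measure (ae_restrict_mem Metric.isOpen_ball.measurableSet) _

/-- The mean value of `U` after one step from `x ∈ Ω` if the players choose `a` and `b`. -/
lemma integral_nextLaw {ε : ℝ} (hε : 0 < ε) {U : Eucl n → ℝ} (hU : Measurable U) {M : ℝ}
    (hM : ∀ x, |U x| ≤ M) {x : Eucl n} (hx : x ∈ G.Ω) (a b : Eucl n) :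
    ∫ y, U y ∂(G.nextLaw ε x a b) =
      G.gamma x * (G.alpha / 2 * (U a + U b) + G.beta * ∫ y, U y ∂(uniformBall ε x))
        + (1 - G.gamma x) * U (G.shift ε x) := by
  have : Fact (0 < ε) := ⟨hε⟩
  have hα := G.alpha_nonneg
  have hβ := G.beta_nonneg
  have hγ := G.gamma_nonneg hx
  have hγ' := sub_nonneg.2 (G.gamma_le_one hx)
  have hi : ∀ (μ : Measure (Eucl n)) [IsFiniteMeasure μ], Integrable U μ := fun μ _ =>
    Integrable.of_bound hU.aestronglyMeasurable M (ae_of_all _ hM)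
  have i1 : ∀ (μ : Measure (Eucl n)) [IsFiniteMeasure μ] (c : ℝ),
      Integrable U (ENNReal.ofReal c • μ) := fun μ _ c => (hi μ).smul_measure ENNReal.ofReal_ne_top
  have hlast : (open Classical in if gradient G.f x = 0 then (0 : Measure (Eucl n)) else
        ENNReal.ofReal (1 - G.gamma x) •
          Measure.dirac (x + (ε ^ 2 / ‖gradient G.f x‖) • gradient G.f x)) =
      ENNReal.ofReal (1 - G.gamma x) • Measure.dirac (G.shift ε x) := by
    -- Where the gradient vanishes `γ = 1`, so the value of `shift` there carries no mass and the
    -- case distinction disappears.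
    split_ifs with h
    · simp [G.gamma_eq_one hx h]
    · rfl
  rw [nextLaw, if_pos hx, stepLaw, hlast,
    integral_add_measure (((i1 _ _).add_measure (i1 _ _)).add_measure (i1 _ _)) (i1 _ _),
    integral_add_measure ((i1 _ _).add_measure (i1 _ _)) (i1 _ _),
    integral_add_measure (i1 _ _) (i1 _ _)]
  simp only [integral_smul_measure, integral_dirac, smul_eq_mul]
  rw [ENNReal.toReal_ofReal (by positivity), ENNReal.toReal_ofReal (by positivity),
    ENNReal.toReal_ofReal hγ']
  ring

lemma nextLaw_region_compl {ε : ℝ} (hε1 : ε ≤ 1) (hε : 0 < ε) {x a b : Eucl n}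
    (hx : x ∈ G.region ε) (ha : a ∈ Metric.ball x ε) (hb : b ∈ Metric.ball x ε) :
    G.nextLaw ε x a b (G.region ε)ᶜ = 0 := by
  have hm := (G.measurableSet_region ε).compl
  unfold nextLaw
  split_ifs with h
  · have hball : ∀ y ∈ Metric.ball x ε, y ∈ G.region ε := fun y hy =>
      G.mem_region_of_dist_le h (Metric.mem_ball.1 hy).le
    have h1 : uniformBall ε x (G.region ε)ᶜ = 0 :=
      (ae_uniformBall ε x).mono hball
    have h2 : G.shift ε x ∈ G.region ε :=
      -- The drift has length at most `ε ^ 2 ≤ ε`; this is where `ε ≤ 1` enters.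
      G.mem_region_of_dist_le h ((G.dist_shift_le x).trans (by nlinarith))
    unfold shift at h2
    simp only [stepLaw, Measure.add_apply, Measure.smul_apply, h1]
    split_ifs <;> simp [h2, Measure.dirac_apply' _ hm, hball a ha, hball b hb]
  · simp [Measure.dirac_apply' _ hm, hx]

end

end WeightedDirichletProblem

/-! ### The exponential barrier -/

namespace WeightedDirichletProblem

noncomputable section

variable {n : ℕ} (G : WeightedDirichletProblem n)

/-- The exponential of a multiple of the first coordinate. -/
def expCoord (K : ℝ) (x : Eucl n) : ℝ := Real.exp (K * x ⟨0, G.dim_pos⟩)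

lemma expCoord_pos (K : ℝ) (x : Eucl n) : 0 < G.expCoord K x := Real.exp_pos _

lemma continuous_expCoord (K : ℝ) : Continuous (G.expCoord K) := by
  unfold expCoord
  fun_prop

lemma isBounded_region {ε : ℝ} (hε : ε ≤ 1) : Bornology.IsBounded (G.region ε) := by
  refine (G.isBounded.union (G.isCompact_frontier.isBounded.cthickening (δ := 1))).subset ?_
  exact Set.union_subset_union_right _ ((G.outerStrip_subset_cthickening ε).trans
    (Metric.cthickening_mono hε _))

lemma exists_expCoord_bounds {ε : ℝ} (hε : ε ≤ 1) (K : ℝ) :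
    ∃ a b : ℝ, 0 < a ∧ ∀ x ∈ G.region ε, a ≤ G.expCoord K x ∧ G.expCoord K x ≤ b := by
  have hc := (G.isBounded_region hε).isCompact_closure
  have hne : (closure (G.region ε)).Nonempty :=
    (G.isConnected.nonempty.mono Set.subset_union_left).closure
  obtain ⟨y, -, hy⟩ := hc.exists_isMinOn hne (G.continuous_expCoord K).continuousOn
  obtain ⟨z, -, hz⟩ := hc.exists_isMaxOn hne (G.continuous_expCoord K).continuousOn
  exact ⟨_, _, G.expCoord_pos K y, fun x hx => ⟨hy (subset_closure hx), hz (subset_closure hx)⟩⟩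

/-- For a steep exponential the random part of the step alone doubles the mean. -/
lemma exists_two_mul_expCoord_le {ε : ℝ} (hε : 0 < ε) :
    ∃ K : ℝ, ∀ x ∈ G.Ω, 2 * G.expCoord K x ≤
      G.gamma x * (G.beta * ∫ y, G.expCoord K y ∂(uniformBall ε x)) := by
  have : Fact (0 < ε) := ⟨hε⟩
  obtain ⟨c, hc, hγ⟩ := G.exists_gamma_ge
  have hβ := G.beta_pos
  set i : Fin n := ⟨0, G.dim_pos⟩ with hi
  -- The probability that the noise lands in a ball of radius `ε / 4` contained in the step ball; by
  -- translation invariance it does not depend on `x`.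
  set q : ℝ := ((volume (Metric.ball (0 : Eucl n) ε))⁻¹ *
    volume (Metric.ball (0 : Eucl n) (ε / 4))).toReal with hq
  have hqpos : 0 < q := by
    refine ENNReal.toReal_pos (mul_ne_zero ?_ ?_) (ENNReal.mul_ne_top ?_ ?_)
    · exact ENNReal.inv_ne_zero.2 measure_ball_lt_top.ne
    · exact (Metric.measure_ball_pos volume _ (by positivity)).ne'
    · exact ENNReal.inv_ne_top.2 (Metric.measure_ball_pos volume _ hε).ne'
    · exact measure_ball_lt_top.ne
  -- Chosen so that `K * (ε / 4) = 2 / (c * β * q)`; then `1 + t ≤ exp t` already gives the factor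
  -- two.
  set K : ℝ := 4 / ε * (2 / (c * G.beta * q)) with hK
  have hKpos : 0 < K := by positivity
  have hexp : 2 ≤ c * G.beta * q * Real.exp (K * (ε / 4)) := by
    have h1 : K * (ε / 4) = 2 / (c * G.beta * q) := by rw [hK]; field_simp
    have h2 := Real.add_one_le_exp (K * (ε / 4))
    have h3 : c * G.beta * q * (K * (ε / 4)) = 2 := by rw [h1]; field_simp
    have h4 : 0 < c * G.beta * q := by positivity
    nlinarith
  refine ⟨K, fun x hx => ?_⟩
  have hcoord : ∀ y : Eucl n, |y i - x i| ≤ dist y x := fun y => by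
    have := PiLp.norm_apply_le (y - x) i
    rwa [dist_eq_norm]
  -- On this ball the first coordinate has increased by at least `ε / 4`; the rest of the step ball
  -- is discarded by positivity.
  set S := Metric.ball (x + EuclideanSpace.single i (ε / 2)) (ε / 4) with hS
  have hSsub : S ⊆ Metric.ball x ε := by
    refine Metric.ball_subset_ball' ?_
    rw [dist_eq_norm, add_sub_cancel_left, PiLp.norm_single,
      Real.norm_of_nonneg (by positivity)]
    linarith
  have hSi : ∀ y ∈ S, x i + ε / 4 ≤ y i := by
    intro y hy
    have h1 := PiLp.norm_apply_le (y - (x + EuclideanSpace.single i (ε / 2))) i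
    rw [← dist_eq_norm] at h1
    have h2 := Metric.mem_ball.1 hy
    simp only [PiLp.sub_apply, PiLp.add_apply, PiLp.single_apply, if_true,
      Real.norm_eq_abs] at h1
    have := (abs_le.1 (h1.trans h2.le)).1
    linarith
  have hSm : (uniformBall ε x).real S = q := by
    rw [hq, Measure.real, uniformBall, Measure.smul_apply, smul_eq_mul,
      Measure.restrict_apply Metric.isOpen_ball.measurableSet, Set.inter_eq_left.2 hSsub,
      Measure.addHaar_ball_center, hS,
      Measure.addHaar_ball_center volume (x + EuclideanSpace.single i (ε / 2))]
  have hint : Integrable (G.expCoord K) (uniformBall ε x) := by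
    refine Integrable.of_bound (G.continuous_expCoord K).measurable.aestronglyMeasurable
      (Real.exp (K * (x i + ε))) ((ae_uniformBall ε x).mono fun y hy => ?_)
    rw [Real.norm_of_nonneg (G.expCoord_pos K y).le]
    refine Real.exp_le_exp.2 (mul_le_mul_of_nonneg_left ?_ hKpos.le)
    have := (abs_le.1 ((hcoord y).trans (Metric.mem_ball.1 hy).le)).2
    linarith
  have hlow : q * Real.exp (K * (x i + ε / 4)) ≤ ∫ y, G.expCoord K y ∂(uniformBall ε x) := by
    calc q * Real.exp (K * (x i + ε / 4))
        = ∫ y, S.indicator (fun _ => Real.exp (K * (x i + ε / 4))) y ∂(uniformBall ε x) := by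
          rw [integral_indicator_const _ Metric.isOpen_ball.measurableSet, hSm, smul_eq_mul]
      _ ≤ _ := by
          refine integral_mono ((integrable_const _).indicator Metric.isOpen_ball.measurableSet)
            hint fun y => ?_
          by_cases hy : y ∈ S
          · rw [Set.indicator_of_mem hy]
            exact Real.exp_le_exp.2 (mul_le_mul_of_nonneg_left (hSi y hy) hKpos.le)
          · rw [Set.indicator_of_notMem hy]
            exact (G.expCoord_pos K y).le
  have hE : Real.exp (K * (x i + ε / 4)) = G.expCoord K x * Real.exp (K * (ε / 4)) := by
    rw [expCoord, ← Real.exp_add, mul_add]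
  have hx0 := G.expCoord_pos K x
  have hg := hγ x hx
  have hg0 := hc.trans_le hg
  calc 2 * G.expCoord K x ≤ c * G.beta * q * Real.exp (K * (ε / 4)) * G.expCoord K x := by gcongr
    _ = c * (G.beta * (q * Real.exp (K * (x i + ε / 4)))) := by rw [hE]; ring
    _ ≤ _ := by gcongr

end

end WeightedDirichletProblem

/-! ### Suprema and infima over open balls, and Borel selections -/

namespace WeightedDirichletProblem

noncomputable section

variable {n : ℕ}

/-- The supremum of `U` over the open ball `B_ε(x)`. -/
def localSup (ε : ℝ) (U : Eucl n → ℝ) (x : Eucl n) : ℝ := sSup (U '' Metric.ball x ε)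

/-- The infimum of `U` over the open ball `B_ε(x)`. -/
def localInf (ε : ℝ) (U : Eucl n → ℝ) (x : Eucl n) : ℝ := sInf (U '' Metric.ball x ε)

section LocalExtrema

variable {ε M : ℝ} {U V : Eucl n → ℝ}

lemma localInf_eq_neg (ε : ℝ) (U : Eucl n → ℝ) (x : Eucl n) :
    localInf ε U x = -localSup ε (-U) x := by
  rw [localInf, localSup, Real.sInf_def, ← Set.image_neg_eq_neg, Set.image_image]
  rfl

lemma bddAbove_image_ball (hM : ∀ x, |U x| ≤ M) (x : Eucl n) :
    BddAbove (U '' Metric.ball x ε) :=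
  ⟨M, by rintro _ ⟨y, -, rfl⟩; exact (abs_le.1 (hM y)).2⟩

lemma le_localSup (hM : ∀ x, |U x| ≤ M) {x y : Eucl n} (hy : y ∈ Metric.ball x ε) :
    U y ≤ localSup ε U x :=
  le_csSup (bddAbove_image_ball hM x) ⟨y, hy, rfl⟩

lemma localSup_le (hε : 0 < ε) {x : Eucl n} {c : ℝ} (h : ∀ y ∈ Metric.ball x ε, U y ≤ c) :
    localSup ε U x ≤ c :=
  csSup_le ⟨_, x, Metric.mem_ball_self hε, rfl⟩ (by rintro _ ⟨y, hy, rfl⟩; exact h y hy)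

lemma abs_neg_apply_le (hM : ∀ x, |U x| ≤ M) (x : Eucl n) : |(-U) x| ≤ M := by
  simpa using hM x

lemma localInf_le (hM : ∀ x, |U x| ≤ M) {x y : Eucl n} (hy : y ∈ Metric.ball x ε) :
    localInf ε U x ≤ U y := by
  have := le_localSup (abs_neg_apply_le hM) hy
  rw [localInf_eq_neg]
  simp only [Pi.neg_apply] at this
  linarith

/-- The superlevel sets are unions of open balls, hence open whatever the regularity of `U`. This is
why moves in open balls cause no measurability problem. -/
lemma measurable_localSup (hε : 0 < ε) (hM : ∀ x, |U x| ≤ M) : Measurable (localSup ε U) := by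
  refine measurable_of_Ioi fun a => IsOpen.measurableSet ?_
  have : localSup ε U ⁻¹' Set.Ioi a = ⋃ y ∈ {y | a < U y}, Metric.ball y ε := by
    ext x
    simp only [Set.mem_preimage, Set.mem_Ioi, Set.mem_iUnion, Set.mem_ofPred_eq, exists_prop]
    constructor
    · intro h
      obtain ⟨_, ⟨y, hy, rfl⟩, hay⟩ :=
        exists_lt_of_lt_csSup (⟨_, x, Metric.mem_ball_self hε, rfl⟩ : (U '' _).Nonempty) h
      exact ⟨y, hay, Metric.mem_ball_comm.1 hy⟩
    · rintro ⟨y, hay, hy⟩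
      exact hay.trans_le (le_localSup hM (Metric.mem_ball_comm.1 hy))
  rw [this]
  exact isOpen_biUnion fun y _ => Metric.isOpen_ball

lemma measurable_localInf (hε : 0 < ε) (hM : ∀ x, |U x| ≤ M) : Measurable (localInf ε U) := by
  have : localInf ε U = -localSup ε (-U) := funext fun x => localInf_eq_neg ε U x
  rw [this]
  exact (measurable_localSup hε (abs_neg_apply_le hM)).neg

lemma abs_localSup_le (hε : 0 < ε) (hM : ∀ x, |U x| ≤ M) (x : Eucl n) :
    |localSup ε U x| ≤ M :=
  abs_le.2 ⟨(abs_le.1 (hM x)).1.trans (le_localSup hM (Metric.mem_ball_self hε)),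
    localSup_le hε fun y _ => (abs_le.1 (hM y)).2⟩

lemma abs_localInf_le (hε : 0 < ε) (hM : ∀ x, |U x| ≤ M) (x : Eucl n) :
    |localInf ε U x| ≤ M := by
  rw [localInf_eq_neg, abs_neg]
  exact abs_localSup_le hε (abs_neg_apply_le hM) x

lemma abs_localSup_sub_le (hε : 0 < ε) {N : ℝ} (hM : ∀ x, |U x| ≤ M) (hN : ∀ x, |V x| ≤ N)
    {x : Eucl n} {c : ℝ} (h : ∀ y ∈ Metric.ball x ε, |U y - V y| ≤ c) :
    |localSup ε U x - localSup ε V x| ≤ c := by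
  rw [abs_sub_le_iff]
  constructor
  · rw [sub_le_iff_le_add]
    refine localSup_le hε fun y hy => ?_
    have := (abs_sub_le_iff.1 (h y hy)).1
    linarith [le_localSup hN hy]
  · rw [sub_le_iff_le_add]
    refine localSup_le hε fun y hy => ?_
    have := (abs_sub_le_iff.1 (h y hy)).2
    linarith [le_localSup hM hy]

lemma abs_localInf_sub_le (hε : 0 < ε) {N : ℝ} (hM : ∀ x, |U x| ≤ M) (hN : ∀ x, |V x| ≤ N)
    {x : Eucl n} {c : ℝ} (h : ∀ y ∈ Metric.ball x ε, |U y - V y| ≤ c) :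
    |localInf ε U x - localInf ε V x| ≤ c := by
  rw [localInf_eq_neg, localInf_eq_neg, neg_sub_neg]
  refine abs_localSup_sub_le hε (abs_neg_apply_le hN) (abs_neg_apply_le hM) fun y hy => ?_
  have := h y hy
  rwa [Pi.neg_apply, Pi.neg_apply, neg_sub_neg]

/-- A Borel selection of almost maximal points in open balls. -/
lemma exists_measurable_almost_max (hε : 0 < ε) (hM : ∀ x, |U x| ≤ M)
    {η : ℝ} (hη : 0 < η) : ∃ S : Eucl n → Eucl n, Measurable S ∧
      ∀ x, S x ∈ Metric.ball x ε ∧ localSup ε U x - η ≤ U (S x) := by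
  classical
  -- Lindelöf: for each rational level, countably many points of the superlevel set already serve
  -- every centre that sees the level.
  have hT : ∀ q : ℚ, ∃ T : Set (Eucl n), T ⊆ {y | (q : ℝ) < U y} ∧ T.Countable ∧
      ⋃ y ∈ T, Metric.ball y ε = ⋃ y ∈ {y | (q : ℝ) < U y}, Metric.ball y ε := fun q =>
    TopologicalSpace.isOpen_biUnion_countable _ _ fun y _ => Metric.isOpen_ball
  choose T hTs hTc hTU using hT
  have hex : ∀ x, ∃ y ∈ ⋃ q, T q, y ∈ Metric.ball x ε ∧ localSup ε U x - η < U y := by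
    intro x
    obtain ⟨q, hq1, hq2⟩ := exists_rat_btwn (sub_lt_self (localSup ε U x) hη)
    obtain ⟨_, ⟨y, hy, rfl⟩, hqy⟩ :=
      exists_lt_of_lt_csSup (⟨_, x, Metric.mem_ball_self hε, rfl⟩ : (U '' _).Nonempty) hq2
    have hx : x ∈ ⋃ y ∈ {y | (q : ℝ) < U y}, Metric.ball y ε :=
      Set.mem_biUnion (show y ∈ {y | (q : ℝ) < U y} from hqy) (Metric.mem_ball_comm.1 hy)
    rw [← hTU q] at hx
    simp only [Set.mem_iUnion, exists_prop] at hx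
    obtain ⟨z, hz, hxz⟩ := hx
    exact ⟨z, Set.mem_iUnion.2 ⟨q, hz⟩, Metric.mem_ball_comm.1 hxz, hq1.trans (hTs q hz)⟩
  obtain ⟨d, hd⟩ := (Set.countable_iUnion hTc).exists_eq_range
    (let ⟨y, hy, _⟩ := hex 0; ⟨y, hy⟩)
  have hex' : ∀ x, ∃ k, d k ∈ Metric.ball x ε ∧ localSup ε U x - η < U (d k) := by
    intro x
    obtain ⟨y, hy, h⟩ := hex x
    rw [hd] at hy
    obtain ⟨k, rfl⟩ := hy
    exact ⟨k, h⟩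
  -- Taking the first admissible point of a countable list makes the selection Borel.
  refine ⟨fun x => d (Nat.find (hex' x)), ?_, fun x => ?_⟩
  · refine measurable_from_nat.comp (measurable_find hex' fun k => ?_)
    have h1 : MeasurableSet {x | d k ∈ Metric.ball x ε} := by
      simp only [Metric.mem_ball_comm (x := d k)]
      exact Metric.isOpen_ball.measurableSet
    have h2 : MeasurableSet {x | localSup ε U x - η < U (d k)} :=
      measurableSet_lt ((measurable_localSup hε hM).sub_const _) measurable_const
    exact h1.inter h2
  · exact ⟨(Nat.find_spec (hex' x)).1, (Nat.find_spec (hex' x)).2.le⟩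

end LocalExtrema

/-! ### The dynamic programming principle and its solution by value iteration -/

variable (G : WeightedDirichletProblem n)

/-- The right-hand side of the dynamic programming principle. -/
def dppMean (ε : ℝ) (U : Eucl n → ℝ) (x : Eucl n) : ℝ :=
  G.gamma x * (G.alpha / 2 * (localSup ε U x + localInf ε U x)
    + G.beta * ∫ y, U y ∂(uniformBall ε x)) + (1 - G.gamma x) * U (G.shift ε x)

/-- Bounded Borel solutions of the dynamic programming principle with boundary values `F`. -/
structure IsDPPSolution (ε M : ℝ) (U : Eucl n → ℝ) : Prop where
  measurable : Measurable U
  bound : ∀ x, |U x| ≤ M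
  eq_F : ∀ x ∈ G.outerStrip ε, U x = G.F x
  eq_dppMean : ∀ x ∈ G.Ω, U x = G.dppMean ε U x

lemma abs_integral_uniformBall_le {ε : ℝ} (hε : 0 < ε) {M : ℝ} {U : Eucl n → ℝ} {x : Eucl n}
    (hM : ∀ y ∈ Metric.ball x ε, |U y| ≤ M) : |∫ y, U y ∂(uniformBall ε x)| ≤ M := by
  have : Fact (0 < ε) := ⟨hε⟩
  have h : ∀ᵐ y ∂(uniformBall ε x), ‖U y‖ ≤ M := (ae_uniformBall ε x).mono hM
  simpa using norm_integral_le_of_norm_le_const h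

lemma abs_dppMean_le {ε : ℝ} (hε : 0 < ε) {M : ℝ} {U : Eucl n → ℝ} (hM : ∀ x, |U x| ≤ M)
    {x : Eucl n} (hx : x ∈ G.Ω) : |G.dppMean ε U x| ≤ M := by
  have : Fact (0 < ε) := ⟨hε⟩
  have hα := G.alpha_nonneg
  have hβ := G.beta_nonneg
  have hγ := G.gamma_nonneg hx
  have hγ' := sub_nonneg.2 (G.gamma_le_one hx)
  have h1 := abs_le.1 (abs_localSup_le hε hM x)
  have h2 := abs_le.1 (abs_localInf_le hε hM x)
  have h3 : |∫ y, U y ∂(uniformBall ε x)| ≤ M := abs_integral_uniformBall_le hε fun y _ => hM y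
  have h3' := abs_le.1 h3
  have h4 := abs_le.1 (hM (G.shift ε x))
  have hb : G.beta = 1 - G.alpha := rfl
  have key : M = G.gamma x * (G.alpha / 2 * (M + M) + G.beta * M) + (1 - G.gamma x) * M := by
    rw [hb]; ring
  rw [dppMean, abs_le]
  constructor
  · have key' : -M = G.gamma x * (G.alpha / 2 * (-M + -M) + G.beta * -M)
      + (1 - G.gamma x) * -M := by rw [hb]; ring
    rw [key']
    gcongr
    exacts [h1.1, h2.1, h3'.1, h4.1]
  · conv_rhs => rw [key]
    gcongr
    exacts [h1.2, h2.2, h3'.2, h4.2]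

/-- The averaging weights sum to one, so a common bound `c` would only give nonexpansiveness.
Keeping a separate bound `d` for the noise exposes the gain from which the contraction is obtained.
-/
lemma abs_dppMean_sub_le {ε : ℝ} (hε : 0 < ε) {M N : ℝ} {U V : Eucl n → ℝ}
    (hM : ∀ x, |U x| ≤ M) (hN : ∀ x, |V x| ≤ N) {x : Eucl n} (hx : x ∈ G.Ω) {c d : ℝ}
    (hball : ∀ y ∈ Metric.ball x ε, |U y - V y| ≤ c)
    (hmean : |∫ y, U y ∂(uniformBall ε x) - ∫ y, V y ∂(uniformBall ε x)| ≤ d)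
    (hshift : |U (G.shift ε x) - V (G.shift ε x)| ≤ c) :
    |G.dppMean ε U x - G.dppMean ε V x| ≤ c - G.gamma x * (G.beta * (c - d)) := by
  have hα := G.alpha_nonneg
  have hβ := G.beta_nonneg
  have hγ := G.gamma_nonneg hx
  have hγ' := sub_nonneg.2 (G.gamma_le_one hx)
  have h1 := abs_localSup_sub_le hε hM hN hball
  have h2 := abs_localInf_sub_le hε hM hN hball
  have hb : G.beta = 1 - G.alpha := rfl
  have e1 : G.dppMean ε U x - G.dppMean ε V x =
      G.gamma x * (G.alpha / 2 * ((localSup ε U x - localSup ε V x)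
        + (localInf ε U x - localInf ε V x))
        + G.beta * (∫ y, U y ∂(uniformBall ε x) - ∫ y, V y ∂(uniformBall ε x)))
        + (1 - G.gamma x) * (U (G.shift ε x) - V (G.shift ε x)) := by
    unfold dppMean; ring
  have e2 : c - G.gamma x * (G.beta * (c - d)) =
      G.gamma x * (G.alpha / 2 * (c + c) + G.beta * d) + (1 - G.gamma x) * c := by
    rw [hb]; ring
  have e3 : -(c - G.gamma x * (G.beta * (c - d))) =
      G.gamma x * (G.alpha / 2 * (-c + -c) + G.beta * -d) + (1 - G.gamma x) * -c := by
    rw [hb]; ring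
  rw [abs_le] at *
  rw [e3, e1, e2]
  constructor
  · gcongr
    exacts [h1.1, h2.1, hmean.1, hshift.1]
  · gcongr
    exacts [h1.2, h2.2, hmean.2, hshift.2]

lemma measurable_dppMean_indicator {ε : ℝ} (hε : 0 < ε) {M : ℝ} {U : Eucl n → ℝ}
    (hU : Measurable U) (hM : ∀ x, |U x| ≤ M) : Measurable (G.Ω.indicator (G.dppMean ε U)) := by
  have key : G.Ω.indicator (G.dppMean ε U) = G.Ω.indicator fun x =>
      G.Ω.indicator G.gamma x * (G.alpha / 2 * (localSup ε U x + localInf ε U x)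
    + G.beta * ∫ y, U y ∂(uniformBall ε x)) + (1 - G.Ω.indicator G.gamma x) * U (G.shift ε x) := by
    ext x
    by_cases hx : x ∈ G.Ω <;> simp [hx, dppMean]
  rw [key]
  have hγ := G.measurable_indicator_gamma
  have hmean : Measurable fun x => ∫ y, U y ∂(uniformBall ε x) := by
    have : IsMarkovKernel (⟨uniformBall ε, measurable_uniformBall ε⟩ : Kernel (Eucl n) (Eucl n)) :=
      ⟨fun x => ⟨uniformBall_univ hε x⟩⟩
    exact (StronglyMeasurable.integral_kernel
      (κ := (⟨uniformBall ε, measurable_uniformBall ε⟩ : Kernel (Eucl n) (Eucl n)))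
      hU.stronglyMeasurable).measurable
  exact ((hγ.mul (((measurable_localSup hε hM).add (measurable_localInf hε hM)).const_mul _
    |>.add (hmean.const_mul _))).add ((measurable_const.sub hγ).mul
      (hU.comp (G.measurable_shift ε)))).indicator G.isOpen.measurableSet

/-- Boundary values are Borel and bounded in a neighbourhood of the boundary. -/
lemma exists_bound_F : ∃ ε₀ M : ℝ, 0 < ε₀ ∧ ε₀ ≤ 1 ∧ 0 ≤ M ∧ ∀ ε < ε₀,
    Measurable ((G.outerStrip ε).indicator G.F) ∧ ∀ x, |(G.outerStrip ε).indicator G.F x| ≤ M := by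
  classical
  obtain ⟨V, hV, hVs, hF⟩ := G.F_continuous_near_boundary
  obtain ⟨δ, hδ, hδV, hsub⟩ := G.exists_outerStrip_subset hV hVs
  obtain ⟨M, hM⟩ := (G.isCompact_frontier.cthickening (r := δ)).exists_bound_of_continuousOn
    (hF.mono hδV)
  refine ⟨min δ 1, max M 0, lt_min hδ one_pos, min_le_right _ _, le_max_right _ _,
    fun ε hε => ⟨?_, fun x => ?_⟩⟩
  · rw [← Set.piecewise_eq_indicator]
    exact (hF.mono ((hsub ε (hε.le.trans (min_le_left _ _))).trans hδV)).measurable_piecewise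
      continuous_zero.continuousOn (G.measurableSet_outerStrip ε)
  · by_cases hx : x ∈ G.outerStrip ε
    · rw [Set.indicator_of_mem hx]
      exact (hM x (hsub ε (hε.le.trans (min_le_left _ _)) hx)).trans (le_max_left _ _)
    · rw [Set.indicator_of_notMem hx, abs_zero]
      exact le_max_right _ _

/-- One step of value iteration. -/
def valueIteration (ε : ℝ) (U : Eucl n → ℝ) : Eucl n → ℝ :=
  open Classical in fun x => if x ∈ G.Ω then G.dppMean ε U x else (G.outerStrip ε).indicator G.F x

/-- The dynamic programming principle has a bounded Borel solution. -/
theorem exists_isDPPSolution {ε : ℝ} (hε : 0 < ε) (hε1 : ε ≤ 1) {M : ℝ}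
    (hF : Measurable ((G.outerStrip ε).indicator G.F))
    (hM : ∀ x, |(G.outerStrip ε).indicator G.F x| ≤ M) :
    ∃ U, G.IsDPPSolution ε M U := by
  classical
  have : Fact (0 < ε) := ⟨hε⟩
  obtain ⟨K, hK⟩ := G.exists_two_mul_expCoord_le hε
  obtain ⟨a, b, ha, hab⟩ := G.exists_expCoord_bounds hε1 K
  have hM0 : 0 ≤ M := (abs_nonneg _).trans (hM 0)
  -- The increments of value iteration are measured against the weight `C - e`, which is at least
  -- one on the region and at most `C`.
  set C := b + 1 with hC
  have hb : a ≤ b := by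
    obtain ⟨x, hx⟩ := G.isConnected.nonempty
    have := hab x (Or.inl hx)
    linarith
  set e := G.expCoord K with he
  set T := G.valueIteration ε with hT
  have hTΩ : ∀ U x, x ∈ G.Ω → T U x = G.dppMean ε U x := fun U x hx => if_pos hx
  have hTn : ∀ U x, x ∉ G.Ω → T U x = (G.outerStrip ε).indicator G.F x := fun U x hx => if_neg hx
  have hTM : ∀ U, (∀ x, |U x| ≤ M) → ∀ x, |T U x| ≤ M := by
    intro U hU x
    by_cases hx : x ∈ G.Ω
    · rw [hTΩ U x hx]; exact G.abs_dppMean_le hε hU hx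
    · rw [hTn U x hx]; exact hM x
  have hTm : ∀ U, Measurable U → (∀ x, |U x| ≤ M) → Measurable (T U) := by
    intro U hUm hU
    have : T U = G.Ω.piecewise (G.Ω.indicator (G.dppMean ε U)) ((G.outerStrip ε).indicator G.F) := by
      ext x
      by_cases hx : x ∈ G.Ω
      · simp [hTΩ, hx]
      · rw [hTn U x hx, Set.piecewise_eq_of_notMem _ _ _ hx]
    rw [this]
    exact (G.measurable_dppMean_indicator hε hUm hU).piecewise G.isOpen.measurableSet hF
  have hint : ∀ U : Eucl n → ℝ, Measurable U → (∀ x, |U x| ≤ M) → ∀ x,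
      Integrable U (uniformBall ε x) := fun U hUm hU x =>
    Integrable.of_bound hUm.aestronglyMeasurable M (ae_of_all _ hU)
  set w : ℕ → Eucl n → ℝ := fun k => T^[k] 0 with hw
  have hws : ∀ k, w (k + 1) = T (w k) := fun k => Function.iterate_succ_apply' T k 0
  have hwM : ∀ k x, |w k x| ≤ M := by
    intro k
    induction k with
    | zero => simpa [hw] using hM0
    | succ k ih => rw [hws]; exact hTM _ ih
  have hwm : ∀ k, Measurable (w k) := by
    intro k
    induction k with
    | zero => exact measurable_zero
    | succ k ih => rw [hws]; exact hTm _ ih (hwM k)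
  set r := 1 - a / C with hr
  have hCpos : 0 < C := by linarith
  have hr0 : 0 ≤ r := by
    rw [hr, sub_nonneg, div_le_one hCpos]; linarith
  have hr1 : r < 1 := by
    have : 0 < a / C := by positivity
    linarith
  -- The ball and drift terms are bounded crudely with `C`; only the noise sees `-e`. Since the
  -- noise doubles `e`, the new bound is `C - 2 * e`, which is at most `r * (C - e)` because `a ≤
  -- e`.
  have hinc : ∀ k, ∀ x ∈ G.region ε, |w (k + 1) x - w k x| ≤ M * r ^ k * (C - e x) := by
    intro k
    induction k with
    | zero =>
      intro x hx
      have h1 := hwM 1 x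
      have h2 := (hab x hx).2
      simp only [hw, zero_add, Function.iterate_zero, id, Pi.zero_apply, sub_zero, pow_zero, mul_one]
      refine h1.trans ?_
      nlinarith
    | succ k ih =>
      intro x hx
      rw [hws (k + 1), hws k]
      by_cases hxΩ : x ∈ G.Ω
      · rw [hTΩ _ x hxΩ, hTΩ _ x hxΩ, ← hws k]
        have hL : 0 ≤ M * r ^ k := by positivity
        have hb' : ∀ y ∈ G.region ε, |w (k + 1) y - w k y| ≤ M * r ^ k * C := fun y hy =>
          (ih y hy).trans (mul_le_mul_of_nonneg_left (by linarith [G.expCoord_pos K y]) hL)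
        have hei : Integrable e (uniformBall ε x) := by
          refine Integrable.of_bound (G.continuous_expCoord K).measurable.aestronglyMeasurable b
            ((ae_uniformBall ε x).mono fun y hy => ?_)
          rw [Real.norm_of_nonneg (G.expCoord_pos K y).le]
          exact (hab y (G.mem_region_of_dist_le hxΩ (Metric.mem_ball.1 hy).le)).2
        have hmean : |∫ y, w (k + 1) y ∂(uniformBall ε x) - ∫ y, w k y ∂(uniformBall ε x)| ≤
            M * r ^ k * (C - ∫ y, e y ∂(uniformBall ε x)) := by
          rw [← integral_sub (hint _ (hwm _) (hwM _) x) (hint _ (hwm _) (hwM _) x)]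
          calc |∫ y, (w (k + 1) y - w k y) ∂(uniformBall ε x)|
              ≤ ∫ y, M * r ^ k * (C - e y) ∂(uniformBall ε x) := by
                rw [← Real.norm_eq_abs]
                refine norm_integral_le_of_norm_le (((integrable_const C).sub hei).const_mul _)
                  ((ae_uniformBall ε x).mono fun y hy => ?_)
                exact ih y (G.mem_region_of_dist_le hxΩ (Metric.mem_ball.1 hy).le)
            _ = _ := by
                rw [integral_const_mul, integral_sub (integrable_const C) hei]
                simp
        refine (G.abs_dppMean_sub_le hε (hwM _) (hwM _) hxΩ (fun y hy =>
          hb' y (G.mem_region_of_dist_le hxΩ (Metric.mem_ball.1 hy).le)) hmean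
          (hb' _ (G.mem_region_of_dist_le hxΩ ((G.dist_shift_le x).trans (by nlinarith))))).trans ?_
        have h2 := hK x hxΩ
        have h3 : a / C * (C - e x) ≤ e x := by
          have h4 := (hab x hx).1
          have h5 := G.expCoord_pos K x
          calc a / C * (C - e x) ≤ a / C * C :=
                mul_le_mul_of_nonneg_left (by linarith) (by positivity)
            _ = a := by field_simp
            _ ≤ e x := h4
        have h6 : C - 2 * e x ≤ r * (C - e x) := by rw [hr]; linarith
        calc _ = M * r ^ k * (C - G.gamma x * (G.beta * ∫ y, e y ∂(uniformBall ε x))) := by ring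
          _ ≤ M * r ^ k * (C - 2 * e x) := mul_le_mul_of_nonneg_left (by linarith) hL
          _ ≤ M * r ^ k * (r * (C - e x)) := mul_le_mul_of_nonneg_left h6 hL
          _ = _ := by ring
      · rw [hTn _ x hxΩ, hTn _ x hxΩ, sub_self, abs_zero]
        have := (hab x hx).2
        exact mul_nonneg (by positivity) (by linarith)
  have hdist : ∀ x k, dist (w k x) (w (k + 1) x) ≤ M * C * r ^ k := by
    intro x k
    rw [dist_comm, Real.dist_eq]
    by_cases hx : x ∈ G.region ε
    · refine (hinc k x hx).trans ?_
      have := G.expCoord_pos K x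
      calc M * r ^ k * (C - e x) ≤ M * r ^ k * C :=
            mul_le_mul_of_nonneg_left (by linarith) (by positivity)
        _ = _ := by ring
    · have h0 : ∀ k, w k x = 0 := by
        intro k
        rcases k with _ | k
        · rfl
        · rw [hws, hTn _ x fun h => hx (Or.inl h), Set.indicator_of_notMem fun h => hx (Or.inr h)]
      rw [h0, h0, sub_self, abs_zero]
      positivity
  have hlim : ∀ x, ∃ l, Tendsto (fun k => w k x) atTop (𝓝 l) := fun x =>
    cauchySeq_tendsto_of_complete (cauchySeq_of_le_geometric r (M * C) hr1 (hdist x))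
  choose W hW using hlim
  have hWM : ∀ x, |W x| ≤ M := fun x => le_of_tendsto' (hW x).abs fun k => hwM k x
  have hWm : Measurable W := measurable_of_tendsto_metrizable hwm (tendsto_pi_nhds.2 hW)
  -- Convergence is uniform with a geometric tail and the averaging is nonexpansive in the supremum
  -- norm, so the limit passes through suprema, infima and integrals.
  have hWfix : ∀ x, T W x = W x := by
    intro x
    refine tendsto_nhds_unique (f := fun k => w (k + 1) x) (l := atTop) ?_
      ((tendsto_add_atTop_iff_nat 1).2 (hW x))
    set c : ℕ → ℝ := fun k => M * C * r ^ k / (1 - r) with hc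
    have hc0 : Tendsto c atTop (𝓝 0) := by
      have := ((tendsto_pow_atTop_nhds_zero_of_lt_one hr0 hr1).const_mul (M * C)).div_const (1 - r)
      simpa using this
    have hwW : ∀ k y, |w k y - W y| ≤ c k := fun k y => by
      rw [← Real.dist_eq]
      exact dist_le_of_le_geometric_of_tendsto r (M * C) hr1 (hdist y) (hW y) k
    rw [tendsto_iff_dist_tendsto_zero]
    refine squeeze_zero (fun _ => dist_nonneg) (fun k => ?_) hc0
    rw [Real.dist_eq, hws]
    by_cases hx : x ∈ G.Ω
    · rw [hTΩ _ x hx, hTΩ _ x hx]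
      refine (G.abs_dppMean_sub_le hε (hwM _) hWM hx (c := c k) (d := c k) (fun y _ => hwW k y) ?_
        (hwW k _)).trans (by simp)
      rw [← integral_sub (hint _ (hwm _) (hwM _) x) (hint _ hWm hWM x)]
      exact abs_integral_uniformBall_le hε fun y _ => hwW k y
    · rw [hTn _ x hx, hTn _ x hx, sub_self, abs_zero]
      exact (abs_nonneg _).trans (hwW k x)
  refine ⟨W, hWm, hWM, fun x hx => ?_, fun x hx => ?_⟩
  · rw [← hWfix, hTn _ x hx.1, Set.indicator_of_mem hx]
  · rw [← hTΩ W x hx, hWfix]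

end

end WeightedDirichletProblem

/-! ### The law of the game: one-step disintegration, absorption and termination -/

namespace Strategy

variable {n : ℕ} {ε : ℝ}

/-- The Markovian strategy which at time `k` moves the token from `x` to `S k x`. -/
def ofSelectors (S : ℕ → Eucl n → Eucl n) (hS : ∀ k, Measurable (S k))
    (hball : ∀ k x, S k x ∈ Metric.ball x ε) : Strategy n ε where
  move k h := S k (h ⟨k, Finset.mem_Iic.2 le_rfl⟩)
  measurable_move k := (hS k).comp (measurable_pi_apply _)
  move_mem k _ := hball k _

end Strategy

namespace WeightedDirichletProblem

noncomputable section

variable {n : ℕ} (G : WeightedDirichletProblem n)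

section GameLaw

variable {ε : ℝ} (hε : 0 < ε) (SA SB : Strategy n ε) (x₀ : Eucl n)

instance isProbabilityMeasure_gameLaw : IsProbabilityMeasure (G.gameLaw hε SA SB x₀) := by
  have := G.isMarkovKernel_transition hε SA SB
  unfold gameLaw
  infer_instance

/-- The history of a play up to time `k`. -/
abbrev history (k : ℕ) (ω : ℕ → Eucl n) : (i : Finset.Iic k) → Eucl n :=
  Preorder.frestrictLe (π := fun _ => Eucl n) k ω

lemma measurable_history (k : ℕ) : Measurable (history (n := n) k) :=
  Preorder.measurable_frestrictLe k

/-- The law of the next position given the play so far. -/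
abbrev nextLawAlong (k : ℕ) (ω : ℕ → Eucl n) : Measure (Eucl n) :=
  G.nextLaw ε (ω k) (SA.move k (history k ω)) (SB.move k (history k ω))

/-- The defining property of the Ionescu-Tulcea measure. All later one-step identities are obtained
by integrating against this disintegration. -/
lemma map_gameLaw_history_next (k : ℕ) :
    (G.gameLaw hε SA SB x₀).map (fun ω => (history k ω, ω (k + 1))) =
      ((G.gameLaw hε SA SB x₀).map (history k)) ⊗ₘ G.transition SA SB k := by
  have := G.isMarkovKernel_transition hε SA SB
  have h1 := Kernel.partialTraj_compProd_eq_map_traj (X := fun _ => Eucl n)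
    (κ := G.transition SA SB) (Nat.zero_le k) (x₀ := fun _ => x₀)
  have h2 := Kernel.traj_map_frestrictLe_apply (X := fun _ => Eucl n)
    (κ := G.transition SA SB) 0 k (fun _ => x₀)
  rw [← h2] at h1
  exact h1.symm

lemma ae_start : ∀ᵐ ω ∂(G.gameLaw hε SA SB x₀), ω 0 = x₀ := by
  have := G.isMarkovKernel_transition hε SA SB
  have h2 := Kernel.traj_map_frestrictLe_apply (X := fun _ => Eucl n)
    (κ := G.transition SA SB) 0 0 (fun _ => x₀)
  rw [Kernel.partialTraj_self, Kernel.id_apply] at h2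
  have h3 : ∀ᵐ h ∂((G.gameLaw hε SA SB x₀).map (history 0)),
      h ⟨0, Finset.mem_Iic.2 le_rfl⟩ = x₀ := by
    rw [show (G.gameLaw hε SA SB x₀).map (history 0) = Measure.dirac (fun _ => x₀) from h2]
    rw [ae_dirac_iff]
    exact measurableSet_eq_fun (measurable_pi_apply _) measurable_const
  exact ae_of_ae_map (measurable_history 0).aemeasurable h3

lemma lintegral_gameLaw_next (k : ℕ) {g : ((i : Finset.Iic k) → Eucl n) × Eucl n → ENNReal}
    (hg : Measurable g) :
    ∫⁻ ω, g (history k ω, ω (k + 1)) ∂(G.gameLaw hε SA SB x₀) =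
      ∫⁻ ω, ∫⁻ y, g (history k ω, y) ∂(G.nextLawAlong SA SB k ω) ∂(G.gameLaw hε SA SB x₀) := by
  have := G.isMarkovKernel_transition hε SA SB
  have hm : Measurable fun ω : ℕ → Eucl n => (history k ω, ω (k + 1)) :=
    (measurable_history k).prodMk (measurable_pi_apply _)
  rw [← lintegral_map (f := g) hg hm, map_gameLaw_history_next, Measure.lintegral_compProd hg,
    lintegral_map hg.lintegral_kernel_prod_right' (measurable_history k)]
  rfl

lemma integral_gameLaw_next (k : ℕ) {g : Eucl n → ℝ} (hg : Measurable g) {M : ℝ}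
    (hM : ∀ x, |g x| ≤ M) :
    Integrable (fun ω => ∫ y, g y ∂(G.nextLawAlong SA SB k ω)) (G.gameLaw hε SA SB x₀) ∧
    ∫ ω, g (ω (k + 1)) ∂(G.gameLaw hε SA SB x₀) =
      ∫ ω, ∫ y, g y ∂(G.nextLawAlong SA SB k ω) ∂(G.gameLaw hε SA SB x₀) := by
  have := G.isMarkovKernel_transition hε SA SB
  have hm : Measurable fun ω : ℕ → Eucl n => (history k ω, ω (k + 1)) :=
    (measurable_history k).prodMk (measurable_pi_apply _)
  have := Measure.isProbabilityMeasure_map (μ := G.gameLaw hε SA SB x₀)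
    (measurable_history k).aemeasurable
  have hi : Integrable (fun q : ((i : Finset.Iic k) → Eucl n) × Eucl n => g q.2)
      (((G.gameLaw hε SA SB x₀).map (history k)) ⊗ₘ G.transition SA SB k) :=
    Integrable.of_bound (hg.comp measurable_snd).aestronglyMeasurable M
      (ae_of_all _ fun q => hM q.2)
  have hi2 : Integrable (fun h => ∫ y, g y ∂(G.transition SA SB k h))
      ((G.gameLaw hε SA SB x₀).map (history k)) := by
    refine Integrable.of_bound
      (StronglyMeasurable.integral_kernel hg.stronglyMeasurable).aestronglyMeasurable M
      (ae_of_all _ fun h => ?_)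
    simpa using norm_integral_le_of_norm_le_const (μ := G.transition SA SB k h) (f := g)
      (ae_of_all _ hM)
  constructor
  · exact (integrable_map_measure hi2.aestronglyMeasurable
      (measurable_history k).aemeasurable).1 hi2
  · have h1 : ∫ ω, g (ω (k + 1)) ∂(G.gameLaw hε SA SB x₀) =
        ∫ q, g q.2 ∂((G.gameLaw hε SA SB x₀).map fun ω => (history k ω, ω (k + 1))) :=
      (integral_map hm.aemeasurable (hg.comp measurable_snd).aestronglyMeasurable).symm
    rw [h1, map_gameLaw_history_next, Measure.integral_compProd hi,
      integral_map (measurable_history k).aemeasurable hi2.aestronglyMeasurable]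
    rfl

lemma integrable_position {g : Eucl n → ℝ} (hg : Measurable g) {M : ℝ}
    (hM : ∀ x, |g x| ≤ M) (k : ℕ) : Integrable (fun ω => g (ω k)) (G.gameLaw hε SA SB x₀) :=
  Integrable.of_bound (hg.comp (measurable_pi_apply k)).aestronglyMeasurable M
    (ae_of_all _ fun ω => hM (ω k))

variable {x₀}

/-- Each transition law charges only the region when started there, so the exceptional sets are null
by induction on time. -/
lemma ae_mem_region (hε1 : ε ≤ 1) (hx₀ : x₀ ∈ G.region ε) :
    ∀ᵐ ω ∂(G.gameLaw hε SA SB x₀), ∀ k, ω k ∈ G.region ε := by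
  rw [ae_all_iff]
  intro k
  have hm := (G.measurableSet_region ε).compl
  induction k with
  | zero =>
    filter_upwards [G.ae_start hε SA SB x₀] with ω hω
    rwa [hω]
  | succ k ih =>
    have hind : Measurable ((G.region ε)ᶜ.indicator (1 : Eucl n → ENNReal)) :=
      measurable_one.indicator hm
    have h := G.lintegral_gameLaw_next hε SA SB x₀ k
      (g := fun q => (G.region ε)ᶜ.indicator 1 q.2) (hind.comp measurable_snd)
    have h0 : ∫⁻ ω, ∫⁻ y, (G.region ε)ᶜ.indicator 1 y ∂(G.nextLawAlong SA SB k ω)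
        ∂(G.gameLaw hε SA SB x₀) = 0 := by
      refine lintegral_eq_zero_of_ae_eq_zero ?_
      filter_upwards [ih] with ω hω
      rw [lintegral_indicator_one hm]
      exact G.nextLaw_region_compl hε1 hε hω (SA.move_mem k (history k ω))
        (SB.move_mem k (history k ω))
    rw [h0] at h
    have hp : Measurable fun ω : ℕ → Eucl n => ω (k + 1) := measurable_pi_apply (k + 1)
    have hz := (lintegral_eq_zero_iff (hind.comp hp)).1 h
    filter_upwards [hz] with ω hω
    by_contra hcon
    simp [hcon] at hω

lemma ae_absorbed : ∀ᵐ ω ∂(G.gameLaw hε SA SB x₀), ∀ k, ω k ∉ G.Ω → ω (k + 1) = ω k := by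
  rw [ae_all_iff]
  intro k
  set A : Set (((i : Finset.Iic k) → Eucl n) × Eucl n) :=
    {q | q.1 ⟨k, Finset.mem_Iic.2 le_rfl⟩ ∉ G.Ω ∧ q.2 ≠ q.1 ⟨k, Finset.mem_Iic.2 le_rfl⟩} with hA
  have hp : Measurable fun q : ((i : Finset.Iic k) → Eucl n) × Eucl n =>
      q.1 ⟨k, Finset.mem_Iic.2 le_rfl⟩ := (measurable_pi_apply _).comp measurable_fst
  have hm : MeasurableSet A :=
    (hp G.isOpen.measurableSet.compl).inter (measurableSet_eq_fun measurable_snd hp).compl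
  have h := G.lintegral_gameLaw_next hε SA SB x₀ k (g := A.indicator 1) (measurable_one.indicator hm)
  have h0 : ∫⁻ ω, ∫⁻ y, A.indicator 1 (history k ω, y) ∂(G.nextLawAlong SA SB k ω)
      ∂(G.gameLaw hε SA SB x₀) = 0 := by
    refine lintegral_eq_zero_of_ae_eq_zero (ae_of_all _ fun ω => ?_)
    have hmy : Measurable fun y => (A.indicator 1 (history k ω, y) : ENNReal) :=
      (measurable_one.indicator hm).comp measurable_prodMk_left
    change ∫⁻ y, A.indicator 1 (history k ω, y) ∂(G.nextLawAlong SA SB k ω) = 0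
    by_cases hω : ω k ∈ G.Ω
    · have : ∀ y, (A.indicator 1 (history k ω, y) : ENNReal) = 0 := fun y =>
        Set.indicator_of_notMem (fun hy => hy.1 hω) _
      simp [this]
    · rw [nextLawAlong, nextLaw, if_neg hω, lintegral_dirac' _ hmy]
      exact Set.indicator_of_notMem (fun hy => hy.2 rfl) _
  rw [h0] at h
  have hp : Measurable fun ω : ℕ → Eucl n => (history k ω, ω (k + 1)) :=
    (measurable_history k).prodMk (measurable_pi_apply (k + 1))
  have hz := (lintegral_eq_zero_iff ((measurable_one.indicator hm).comp hp)).1 h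
  filter_upwards [hz] with ω hω hωΩ
  by_contra hcon
  have : (history k ω, ω (k + 1)) ∈ A := ⟨hωΩ, hcon⟩
  simp [this] at hω

/-- The mean of the barrier increases at each step by at least `a` times the probability of being in
`Ω`, hence by at least `a` times the probability of never leaving. As the barrier is bounded on the
region, the latter probability is zero. -/
lemma ae_exists_mem_outerStrip (hε1 : ε ≤ 1) (hx₀ : x₀ ∈ G.region ε) :
    ∀ᵐ ω ∂(G.gameLaw hε SA SB x₀), ∃ k, ω k ∈ G.outerStrip ε := by
  have : Fact (0 < ε) := ⟨hε⟩
  obtain ⟨K, hK⟩ := G.exists_two_mul_expCoord_le hε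
  obtain ⟨a, b, ha, hab⟩ := G.exists_expCoord_bounds hε1 K
  set μ := G.gameLaw hε SA SB x₀ with hμ
  have hreg := G.ae_mem_region hε SA SB hε1 hx₀
  set e := (G.region ε).indicator (G.expCoord K) with he
  have hem : Measurable e :=
    (G.continuous_expCoord K).measurable.indicator (G.measurableSet_region ε)
  have hb0 : 0 ≤ b := by
    have := hab x₀ hx₀
    linarith
  have he0 : ∀ x, 0 ≤ e x := Set.indicator_nonneg fun x _ => (G.expCoord_pos K x).le
  have heb : ∀ x, e x ≤ b := fun x => Set.indicator_le' (fun x hx => (hab x hx).2)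
    (fun _ _ => hb0) x
  have heM : ∀ x, |e x| ≤ b := fun x => by rw [abs_of_nonneg (he0 x)]; exact heb x
  have hstep : ∀ x ∈ G.region ε, ∀ p q,
      e x + G.Ω.indicator (fun _ => a) x ≤ ∫ y, e y ∂(G.nextLaw ε x p q) := by
    intro x hx p q
    by_cases hxΩ : x ∈ G.Ω
    · rw [G.integral_nextLaw hε hem heM hxΩ, Set.indicator_of_mem hxΩ]
      have h1 : ∫ y, e y ∂(uniformBall ε x) = ∫ y, G.expCoord K y ∂(uniformBall ε x) :=
        integral_congr_ae ((ae_uniformBall ε x).mono fun y hy => Set.indicator_of_mem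
          (G.mem_region_of_dist_le hxΩ (Metric.mem_ball.1 hy).le) _)
      have h2 : e x = G.expCoord K x := Set.indicator_of_mem hx _
      have h3 := hK x hxΩ
      have h4 := (hab x hx).1
      have hα := G.alpha_nonneg
      have hγ := G.gamma_nonneg hxΩ
      have hγ' := sub_nonneg.2 (G.gamma_le_one hxΩ)
      have h5 : 0 ≤ (1 - G.gamma x) * e (G.shift ε x) := mul_nonneg hγ' (he0 _)
      have h6 : 0 ≤ G.gamma x * (G.alpha / 2 * (e p + e q)) :=
        mul_nonneg hγ (mul_nonneg (by positivity) (add_nonneg (he0 _) (he0 _)))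
      rw [h1, mul_add, h2]
      linarith
    · have h := G.nextLaw ε x p q
      rw [nextLaw, if_neg hxΩ, integral_dirac, Set.indicator_of_notMem hxΩ, add_zero]
  have hΩm := G.isOpen.measurableSet
  set P : ℝ := μ.real {ω | ∀ k, ω k ∈ G.Ω} with hP
  have hPk : ∀ k, a * P ≤ ∫ ω, G.Ω.indicator (fun _ => a) (ω k) ∂μ := by
    intro k
    have h1 : (fun ω : ℕ → Eucl n => G.Ω.indicator (fun _ => a) (ω k)) =
        {ω : ℕ → Eucl n | ω k ∈ G.Ω}.indicator fun _ => a := rfl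
    have h2 : MeasurableSet {ω : ℕ → Eucl n | ω k ∈ G.Ω} := by
      have hp : Measurable fun ω : ℕ → Eucl n => ω k := measurable_pi_apply k
      exact hp hΩm
    rw [h1, integral_indicator_const _ h2, smul_eq_mul, mul_comm]
    gcongr
    exact measureReal_mono fun ω hω => hω k
  have hgrow : ∀ k, k * (a * P) ≤ ∫ ω, e (ω k) ∂μ := by
    intro k
    induction k with
    | zero => simpa using integral_nonneg fun ω : ℕ → Eucl n => he0 (ω 0)
    | succ k ih =>
      obtain ⟨hi, hn⟩ := G.integral_gameLaw_next hε SA SB x₀ k hem heM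
      have hi1 := G.integrable_position hε SA SB x₀ hem heM k
      have hi2 := G.integrable_position hε SA SB x₀ (g := G.Ω.indicator fun _ => a)
        (measurable_const.indicator hΩm) (M := a) (fun x => by
          by_cases hx : x ∈ G.Ω <;> simp [hx, abs_of_pos ha, ha.le]) k
      rw [hn]
      calc ((k + 1 : ℕ) : ℝ) * (a * P) = k * (a * P) + a * P := by push_cast; ring
        _ ≤ ∫ ω, e (ω k) ∂μ + ∫ ω, G.Ω.indicator (fun _ => a) (ω k) ∂μ := add_le_add ih (hPk k)
        _ = ∫ ω, (e (ω k) + G.Ω.indicator (fun _ => a) (ω k)) ∂μ := (integral_add hi1 hi2).symm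
        _ ≤ _ := by
          refine integral_mono_ae (hi1.add hi2) hi ?_
          filter_upwards [hreg] with ω hω
          exact hstep _ (hω k) _ _
  have hupp : ∀ k : ℕ, k * (a * P) ≤ b := by
    intro k
    refine (hgrow k).trans ?_
    calc ∫ ω, e (ω k) ∂μ ≤ ∫ _, b ∂μ := integral_mono
          (G.integrable_position hε SA SB x₀ hem heM k) (integrable_const b) fun ω => heb _
      _ = b := by simp
  have hP0 : P = 0 := by
    by_contra hne
    have hpos : 0 < a * P := mul_pos ha (lt_of_le_of_ne measureReal_nonneg (Ne.symm hne))
    obtain ⟨k, hk⟩ := exists_nat_gt (b / (a * P))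
    rw [div_lt_iff₀ hpos] at hk
    exact absurd (hupp k) (not_le.2 hk)
  have hnull : μ {ω | ∀ k, ω k ∈ G.Ω} = 0 := by
    rwa [hP, measureReal_eq_zero_iff] at hP0
  have hae : ∀ᵐ ω ∂μ, ¬ ∀ k, ω k ∈ G.Ω := by
    rw [ae_iff]
    simpa using hnull
  filter_upwards [hae, hreg] with ω h1 h2
  obtain ⟨k, hk⟩ := not_forall.1 h1
  exact ⟨k, (h2 k).resolve_left hk⟩

/-- After the exit time the token is frozen, so the sequence is eventually constant. -/
lemma ae_tendsto_payoff (hε1 : ε ≤ 1) (hx₀ : x₀ ∈ G.region ε) {U : Eucl n → ℝ}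
    (hU : ∀ x ∈ G.outerStrip ε, U x = G.F x) :
    ∀ᵐ ω ∂(G.gameLaw hε SA SB x₀), Tendsto (fun k => U (ω k)) atTop (𝓝 (G.payoff ε ω)) := by
  filter_upwards [G.ae_exists_mem_outerStrip hε SA SB hε1 hx₀, G.ae_absorbed hε SA SB]
    with ω h1 h2
  have hτ : ω (G.exitTime ε ω) ∈ G.outerStrip ε := Nat.sInf_mem h1
  have hc : ∀ j, ω (G.exitTime ε ω + j) = ω (G.exitTime ε ω) := by
    intro j
    induction j with
    | zero => rfl
    | succ j ih => rw [← add_assoc, h2 _ (by rw [ih]; exact hτ.1), ih]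
  refine tendsto_const_nhds.congr' ?_
  filter_upwards [eventually_ge_atTop (G.exitTime ε ω)] with k hk
  obtain ⟨j, rfl⟩ := Nat.exists_eq_add_of_le hk
  rw [hc, hU _ hτ]
  rfl

/-- Dominated convergence. Measurability of the payoff, too, comes from the almost sure limit:
neither measurability of `F` as a total function nor of the exit time is used. -/
lemma tendsto_integral_payoff (hε1 : ε ≤ 1) (hx₀ : x₀ ∈ G.region ε) {U : Eucl n → ℝ}
    (hU : ∀ x ∈ G.outerStrip ε, U x = G.F x) (hUm : Measurable U) {M : ℝ} (hM : ∀ x, |U x| ≤ M) :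
    Integrable (G.payoff ε) (G.gameLaw hε SA SB x₀) ∧
    Tendsto (fun k => ∫ ω, U (ω k) ∂(G.gameLaw hε SA SB x₀)) atTop
      (𝓝 (∫ ω, G.payoff ε ω ∂(G.gameLaw hε SA SB x₀))) := by
  have hlim := G.ae_tendsto_payoff hε SA SB hε1 hx₀ hU
  have hm : ∀ k, AEStronglyMeasurable (fun ω : ℕ → Eucl n => U (ω k)) (G.gameLaw hε SA SB x₀) :=
    fun k => (hUm.comp (measurable_pi_apply k)).aestronglyMeasurable
  constructor
  · refine Integrable.of_bound (aestronglyMeasurable_of_tendsto_ae atTop hm hlim) M ?_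
    filter_upwards [hlim] with ω hω
    exact le_of_tendsto' hω.norm fun k => hM _
  · exact tendsto_integral_of_dominated_convergence (fun _ => M) hm (integrable_const M)
      (fun k => ae_of_all _ fun ω => hM _) hlim

end GameLaw

theorem isWellPosed_of_bound {ε : ℝ} (hε : 0 < ε) (hε1 : ε ≤ 1) {M : ℝ}
    (hF : Measurable ((G.outerStrip ε).indicator G.F))
    (hM : ∀ x, |(G.outerStrip ε).indicator G.F x| ≤ M) : G.IsWellPosed hε := fun SA SB _ hx₀ =>
  ⟨G.ae_exists_mem_outerStrip hε SA SB hε1 hx₀, (G.tendsto_integral_payoff hε SA SB hε1 hx₀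
    (fun _ hx => Set.indicator_of_mem hx _) hF hM).1⟩

/-! ### Almost optimal strategies and the value of the game -/

section Value

variable {G} {ε M : ℝ} {U : Eucl n → ℝ}

/-- One player almost attains the supremum, and the opponent cannot do worse to them than the
infimum. The two chosen moves have equal weight, so the bound holds in either role. -/
lemma IsDPPSolution.le_integral_nextLaw (hU : G.IsDPPSolution ε M U) (hε : 0 < ε) {x a b : Eucl n}
    {η : ℝ} (hη : 0 ≤ η) (ha : localSup ε U x - η ≤ U a) (hb : b ∈ Metric.ball x ε) :
    U x - η ≤ ∫ y, U y ∂(G.nextLaw ε x a b) ∧ U x - η ≤ ∫ y, U y ∂(G.nextLaw ε x b a) := by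
  by_cases hx : x ∈ G.Ω
  · have h1 : U x - η ≤ G.gamma x * (G.alpha / 2 * (U a + U b)
        + G.beta * ∫ y, U y ∂(uniformBall ε x)) + (1 - G.gamma x) * U (G.shift ε x) := by
      have h2 := localInf_le hU.bound hb
      have hα := G.alpha_nonneg
      have hβ := G.beta_nonneg
      have hγ := G.gamma_nonneg hx
      have hγ' := G.gamma_le_one hx
      have hα1 : G.alpha ≤ 1 := by
        have : G.beta = 1 - G.alpha := rfl
        linarith
      have h3 : G.gamma x * (G.alpha / 2) * (localSup ε U x - η + localInf ε U x) ≤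
          G.gamma x * (G.alpha / 2) * (U a + U b) :=
        mul_le_mul_of_nonneg_left (by linarith) (by positivity)
      have h4 : G.gamma x * (G.alpha / 2) ≤ 1 :=
        mul_le_one₀ hγ' (by positivity) (by linarith)
      have h5 : G.gamma x * (G.alpha / 2) * η ≤ 1 * η := mul_le_mul_of_nonneg_right h4 hη
      rw [hU.eq_dppMean x hx, dppMean]
      linarith
    constructor
    · rw [G.integral_nextLaw hε hU.measurable hU.bound hx]
      exact h1
    · rw [G.integral_nextLaw hε hU.measurable hU.bound hx, add_comm (U b)]
      exact h1
  · simp only [nextLaw, if_neg hx, integral_dirac]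
    constructor <;> linarith

/-- If along every play the mean of `U` decreases by at most `η / 2 ^ (k + 1)` at time `k`, then the
mean payoff is at least `U (x₀) - η`. -/
lemma IsDPPSolution.sub_le_integral_payoff (hU : G.IsDPPSolution ε M U) (hε : 0 < ε) (hε1 : ε ≤ 1)
    {SA SB : Strategy n ε} {x₀ : Eucl n} (hx₀ : x₀ ∈ G.region ε) {η : ℝ} (hη : 0 ≤ η)
    (h : ∀ k ω, U (ω k) - η * (1 / 2) ^ (k + 1) ≤ ∫ y, U y ∂(G.nextLawAlong SA SB k ω)) :
    U x₀ - η ≤ ∫ ω, G.payoff ε ω ∂(G.gameLaw hε SA SB x₀) := by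
  set μ := G.gameLaw hε SA SB x₀
  -- The losses `η / 2 ^ (j + 1)` for `j < k` sum to `η * (1 - 2 ^ (-k))`, which stays below `η` for
  -- all times.
  have hstep : ∀ k, U x₀ - η * (1 - (1 / 2) ^ k) ≤ ∫ ω, U (ω k) ∂μ := by
    intro k
    induction k with
    | zero =>
      have : ∫ ω, U (ω 0) ∂μ = ∫ _, U x₀ ∂μ := integral_congr_ae (by
        filter_upwards [G.ae_start hε SA SB x₀] with ω hω
        rw [hω])
      simp [this]
    | succ k ih =>
      obtain ⟨hi, hn⟩ := G.integral_gameLaw_next hε SA SB x₀ k hU.measurable hU.bound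
      have hi1 := G.integrable_position hε SA SB x₀ hU.measurable hU.bound k
      rw [hn]
      calc U x₀ - η * (1 - (1 / 2) ^ (k + 1))
          = U x₀ - η * (1 - (1 / 2) ^ k) - η * (1 / 2) ^ (k + 1) := by ring
        _ ≤ ∫ ω, U (ω k) ∂μ - η * (1 / 2) ^ (k + 1) := by linarith
        _ = ∫ ω, (U (ω k) - η * (1 / 2) ^ (k + 1)) ∂μ := by
          rw [integral_sub hi1 (integrable_const _)]
          simp [μ]
        _ ≤ _ := integral_mono (hi1.sub (integrable_const _)) hi fun ω => h k ω
  refine ge_of_tendsto' (G.tendsto_integral_payoff hε SA SB hε1 hx₀ hU.eq_F hU.measurable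
    hU.bound).2 fun k => (le_trans ?_ (hstep k))
  have : (0 : ℝ) ≤ η * (1 / 2) ^ k := by positivity
  linarith

/-- The accuracy of the selection is halved at each time, so that the total loss over an unbounded
play is at most `η`. The same strategy serves the first and the second player. -/
lemma IsDPPSolution.exists_strategy (hU : G.IsDPPSolution ε M U) (hε : 0 < ε) (hε1 : ε ≤ 1)
    {x₀ : Eucl n} (hx₀ : x₀ ∈ G.region ε) {η : ℝ} (hη : 0 < η) :
    ∃ S : Strategy n ε, ∀ S' : Strategy n ε,
      U x₀ - η ≤ ∫ ω, G.payoff ε ω ∂(G.gameLaw hε S S' x₀) ∧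
      U x₀ - η ≤ ∫ ω, G.payoff ε ω ∂(G.gameLaw hε S' S x₀) := by
  have hsel : ∀ k : ℕ, ∃ S : Eucl n → Eucl n, Measurable S ∧
      ∀ x, S x ∈ Metric.ball x ε ∧ localSup ε U x - η * (1 / 2) ^ (k + 1) ≤ U (S x) := fun k =>
    exists_measurable_almost_max hε hU.bound (by positivity)
  choose S hSm hS using hsel
  refine ⟨Strategy.ofSelectors S hSm fun k x => (hS k x).1, fun S' => ⟨?_, ?_⟩⟩
  · exact hU.sub_le_integral_payoff hε hε1 hx₀ hη.le fun k ω =>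
      (hU.le_integral_nextLaw hε (by positivity) (hS k (ω k)).2 (S'.move_mem k (history k ω))).1
  · exact hU.sub_le_integral_payoff hε hε1 hx₀ hη.le fun k ω =>
      (hU.le_integral_nextLaw hε (by positivity) (hS k (ω k)).2 (S'.move_mem k (history k ω))).2

end Value

/-- The problem with boundary values `-F`. -/
def neg : WeightedDirichletProblem n :=
  { G with
    F := fun x => -G.F x
    F_continuous_near_boundary :=
      let ⟨V, h1, h2, h3⟩ := G.F_continuous_near_boundary
      ⟨V, h1, h2, h3.neg⟩ }

/-- Negation exchanges supremum and infimum, which enter the mean symmetrically. -/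
lemma IsDPPSolution.neg {G : WeightedDirichletProblem n} {ε M : ℝ} {U : Eucl n → ℝ}
    (hU : G.IsDPPSolution ε M U) : G.neg.IsDPPSolution ε M (-U) where
  measurable := hU.measurable.neg
  bound := abs_neg_apply_le hU.bound
  eq_F x hx := congrArg Neg.neg (hU.eq_F x hx)
  eq_dppMean x hx := by
    have h1 : localSup ε (-U) x = -localInf ε U x := by rw [localInf_eq_neg, neg_neg]
    have h2 : localInf ε (-U) x = -localSup ε U x := by rw [localInf_eq_neg, neg_neg]
    have h := hU.eq_dppMean x hx
    change -(U x) = G.gamma x * (G.alpha / 2 * (localSup ε (-U) x + localInf ε (-U) x)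
      + G.beta * ∫ y, -(U y) ∂(uniformBall ε x)) + (1 - G.gamma x) * -(U (G.shift ε x))
    rw [h1, h2, h, dppMean, integral_neg]
    ring

lemma integral_payoff_neg {ε : ℝ} (hε : 0 < ε) (SA SB : Strategy n ε) (x₀ : Eucl n) :
    ∫ ω, G.neg.payoff ε ω ∂(G.neg.gameLaw hε SA SB x₀) =
      -∫ ω, G.payoff ε ω ∂(G.gameLaw hε SA SB x₀) :=
  integral_neg _

/-- The game has a value: the solution of the dynamic programming principle. -/
theorem IsDPPSolution.value_eq {G : WeightedDirichletProblem n} {ε M : ℝ} {U : Eucl n → ℝ}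
    (hU : G.IsDPPSolution ε M U) (hε : 0 < ε) (hε1 : ε ≤ 1)
    {x₀ : Eucl n} (hx₀ : x₀ ∈ G.region ε) : G.value hε x₀ = U x₀ := by
  refine le_antisymm ?_ ?_
  · refine iSup_le fun SA => EReal.le_of_forall_lt_iff_le.1 fun c hc => ?_
    have hη : 0 < c - U x₀ := sub_pos.2 (EReal.coe_lt_coe_iff.1 hc)
    -- The minimizing player replies to every `SA` with a nearly maximizing strategy for the game
    -- with payoff `-F`.
    obtain ⟨S, hS⟩ := hU.neg.exists_strategy hε hε1 hx₀ hη
    refine (iInf_le _ S).trans (EReal.coe_le_coe_iff.2 ?_)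
    have := (hS SA).2
    rw [integral_payoff_neg, Pi.neg_apply] at this
    linarith
  · refine EReal.ge_of_forall_gt_iff_ge.1 fun c hc => ?_
    have hη : 0 < U x₀ - c := sub_pos.2 (EReal.coe_lt_coe_iff.1 hc)
    obtain ⟨S, hS⟩ := hU.exists_strategy hε hε1 hx₀ hη
    refine le_trans (le_iInf fun SB => EReal.coe_le_coe_iff.2 ?_) (le_iSup (fun SA => ⨅ SB : Strategy n ε,
      ((∫ ω, G.payoff ε ω ∂(G.gameLaw hε SA SB x₀) : ℝ) : EReal)) S)
    have := (hS SB).1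
    linarith

end

end WeightedDirichletProblem

/-! ### Half-relaxed limits of the values -/

namespace WeightedDirichletProblem

noncomputable section

variable {n : ℕ} (G : WeightedDirichletProblem n)

/-- A family of real-valued functions representing the values of the games with small steps. -/
structure IsValueFamily (ε₀ M : ℝ) (U : ℝ → Eucl n → ℝ) : Prop where
  pos : 0 < ε₀
  le_one : ε₀ ≤ 1
  isDPPSolution : ∀ ε, 0 < ε → ε < ε₀ → G.IsDPPSolution ε M (U ε)

lemma exists_isValueFamily : ∃ ε₀ M U, G.IsValueFamily ε₀ M U ∧
    ∀ (ε : ℝ) (hε : 0 < ε), ε < ε₀ → G.IsWellPosed hε := by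
  obtain ⟨ε₀, M, h0, h1, -, hF⟩ := G.exists_bound_F
  have h : ∀ ε, ∃ U, 0 < ε → ε < ε₀ → G.IsDPPSolution ε M U := by
    intro ε
    by_cases hε : 0 < ε ∧ ε < ε₀
    · obtain ⟨U, hU⟩ := G.exists_isDPPSolution hε.1 (hε.2.le.trans h1) (hF ε hε.2).1 (hF ε hε.2).2
      exact ⟨U, fun _ _ => hU⟩
    · exact ⟨0, fun h h' => absurd ⟨h, h'⟩ hε⟩
  choose U hU using h
  exact ⟨ε₀, M, U, ⟨h0, h1, hU⟩, fun ε hε hlt =>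
    G.isWellPosed_of_bound hε (hlt.le.trans h1) (hF ε hlt).1 (hF ε hlt).2⟩

variable {G} {ε₀ M : ℝ} {U : ℝ → Eucl n → ℝ}

lemma IsValueFamily.value_eq (hU : G.IsValueFamily ε₀ M U) {ε : ℝ} (hε : 0 < ε) (hlt : ε < ε₀)
    {y : Eucl n} (hy : y ∈ closure G.Ω) : G.value hε y = U ε y :=
  (hU.isDPPSolution ε hε hlt).value_eq hε (hlt.le.trans hU.le_one) (G.closure_subset_region hε hy)

lemma IsValueFamily.neg (hU : G.IsValueFamily ε₀ M U) :
    G.neg.IsValueFamily ε₀ M fun ε => -U ε :=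
  ⟨hU.pos, hU.le_one, fun ε h1 h2 => (hU.isDPPSolution ε h1 h2).neg⟩

lemma nearbyValues_mono (x : Eucl n) : Monotone (G.nearbyValues x) := by
  rintro ν ν' h t ⟨ε, hε, y, hy, hd, ht⟩
  exact ⟨ε, hε, y, hy, hd.trans h, ht⟩

lemma nearbyValues_subset {x y : Eucl n} {ν : ℝ} (h : dist y x ≤ ν / 2) :
    G.nearbyValues y (ν / 2) ⊆ G.nearbyValues x ν := by
  rintro t ⟨ε, hε, z, hz, hd, ht⟩
  exact ⟨ε, hε, z, hz, by linarith [dist_triangle z y x], ht⟩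

lemma sSup_nearbyValues_mono (x : Eucl n) : Monotone fun ν => sSup (G.nearbyValues x ν) :=
  fun _ _ h => sSup_le_sSup (nearbyValues_mono x h)

/-- The suprema are monotone in `ν`, so they converge in the extended reals to their infimum; the
uniform bound `M` confines it to `[-M, M]`. -/
lemma IsValueFamily.exists_isUpperHalfRelaxedLimit (hU : G.IsValueFamily ε₀ M U) :
    ∃ u : Eucl n → ℝ, G.IsUpperHalfRelaxedLimit u := by
  have h : ∀ x, ∃ r : ℝ, x ∈ closure G.Ω →
      Tendsto (fun ν : ℝ => sSup (G.nearbyValues x ν)) (𝓝[>] 0) (𝓝 (r : EReal)) := by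
    intro x
    by_cases hx : x ∈ closure G.Ω
    · set L := sInf ((fun ν : ℝ => sSup (G.nearbyValues x ν)) '' Set.Ioi 0) with hL
      have hlim : Tendsto (fun ν : ℝ => sSup (G.nearbyValues x ν)) (𝓝[>] 0) (𝓝 L) :=
        (sSup_nearbyValues_mono x).tendsto_nhdsGT 0
      have hlow : ((-M : ℝ) : EReal) ≤ L := by
        refine le_sInf ?_
        rintro _ ⟨ν, hν, rfl⟩
        have hν : 0 < ν := hν
        have hpos : 0 < min ν ε₀ / 2 := half_pos (lt_min hν hU.pos)
        have h1 : min ν ε₀ / 2 < min ν ε₀ := half_lt_self (lt_min hν hU.pos)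
        have h2 : min ν ε₀ / 2 < ε₀ := h1.trans_le (min_le_right _ _)
        refine le_trans ?_ (le_sSup ⟨min ν ε₀ / 2, hpos, x, hx, ?_, rfl⟩)
        · rw [hU.value_eq hpos h2 hx, EReal.coe_le_coe_iff]
          exact (abs_le.1 ((hU.isDPPSolution _ hpos h2).bound x)).1
        · rw [dist_self, zero_add]
          exact h1.le.trans (min_le_left _ _)
      have hupp : L ≤ (M : EReal) := by
        refine (sInf_le (Set.mem_image_of_mem (fun ν : ℝ => sSup (G.nearbyValues x ν))
          (Set.mem_Ioi.2 (half_pos hU.pos)))).trans (sSup_le ?_)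
        rintro _ ⟨ε, hε, y, hy, hd, rfl⟩
        have h2 : ε < ε₀ := by linarith [dist_nonneg (x := y) (y := x), hU.pos]
        rw [hU.value_eq hε h2 hy, EReal.coe_le_coe_iff]
        exact (abs_le.1 ((hU.isDPPSolution _ hε h2).bound y)).2
      refine ⟨L.toReal, fun _ => ?_⟩
      rwa [EReal.coe_toReal (ne_top_of_le_ne_top (EReal.coe_ne_top M) hupp)
        (ne_bot_of_le_ne_bot (EReal.coe_ne_bot (-M)) hlow)]
    · exact ⟨0, fun h => absurd h hx⟩
  choose u hu using h
  exact ⟨u, hu⟩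

lemma IsUpperHalfRelaxedLimit.le_sSup {u : Eucl n → ℝ} (hu : G.IsUpperHalfRelaxedLimit u)
    {x : Eucl n} (hx : x ∈ closure G.Ω) {ν : ℝ} (hν : 0 < ν) :
    (u x : EReal) ≤ sSup (G.nearbyValues x ν) := by
  refine le_of_tendsto (hu x hx) ?_
  filter_upwards [Ioo_mem_nhdsGT hν] with ν' hν'
  exact sSup_nearbyValues_mono x hν'.2.le

lemma IsUpperHalfRelaxedLimit.exists_sSup_lt {u : Eucl n → ℝ} (hu : G.IsUpperHalfRelaxedLimit u)
    {x : Eucl n} (hx : x ∈ closure G.Ω) {c : ℝ} (hc : u x < c) :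
    ∃ ν > 0, sSup (G.nearbyValues x ν) < (c : EReal) := by
  have h := ((hu x hx).eventually_lt_const (EReal.coe_lt_coe_iff.2 hc)).and self_mem_nhdsWithin
  obtain ⟨ν, h1, h2⟩ := h.exists
  exact ⟨ν, h2, h1⟩

lemma IsUpperHalfRelaxedLimit.upperSemicontinuousOn {u : Eucl n → ℝ}
    (hu : G.IsUpperHalfRelaxedLimit u) : UpperSemicontinuousOn u (closure G.Ω) := by
  intro x hx c hc
  obtain ⟨ν, hν, h⟩ := hu.exists_sSup_lt hx hc
  filter_upwards [self_mem_nhdsWithin,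
    mem_nhdsWithin_of_mem_nhds (Metric.closedBall_mem_nhds x (half_pos hν))] with y hy hd
  exact EReal.coe_lt_coe_iff.1 (((hu.le_sSup hy (half_pos hν)).trans
    (sSup_le_sSup (nearbyValues_subset hd))).trans_lt h)

/-- Near `x` the values of the games with small steps are less than every `c > u x`. -/
lemma IsValueFamily.exists_forall_lt (hU : G.IsValueFamily ε₀ M U) {u : Eucl n → ℝ}
    (hu : G.IsUpperHalfRelaxedLimit u) {x : Eucl n} (hx : x ∈ closure G.Ω) {c : ℝ} (hc : u x < c) :
    ∃ ν > 0, ∀ ε, 0 < ε → ε < ν → ∀ y ∈ closure G.Ω, dist y x < ν → U ε y < c := by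
  obtain ⟨ν, hν, h⟩ := hu.exists_sSup_lt hx hc
  refine ⟨min (ν / 2) ε₀, lt_min (half_pos hν) hU.pos, fun ε hε h1 y hy h2 => ?_⟩
  rw [lt_min_iff] at h1 h2
  refine EReal.coe_lt_coe_iff.1 (lt_of_le_of_lt ?_ h)
  rw [← hU.value_eq hε h1.2 hy]
  exact le_sSup ⟨ε, hε, y, hy, by linarith, rfl⟩

lemma IsValueFamily.exists_gt (hU : G.IsValueFamily ε₀ M U) {u : Eucl n → ℝ}
    (hu : G.IsUpperHalfRelaxedLimit u) {x : Eucl n} (hx : x ∈ closure G.Ω) {c : ℝ} (hc : c < u x)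
    {ν : ℝ} (hν : 0 < ν) :
    ∃ ε, 0 < ε ∧ ε < ν ∧ ∃ y ∈ closure G.Ω, dist y x < ν ∧ c < U ε y := by
  have hpos : 0 < min ν ε₀ / 2 := half_pos (lt_min hν hU.pos)
  have h1 : min ν ε₀ / 2 < min ν ε₀ := half_lt_self (lt_min hν hU.pos)
  have h := (EReal.coe_lt_coe_iff.2 hc).trans_le (hu.le_sSup hx hpos)
  obtain ⟨_, ⟨ε, hε, y, hy, hd, rfl⟩, hlt⟩ := lt_sSup_iff.1 h
  have h2 := dist_nonneg (x := y) (y := x)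
  have h3 : ε < min ν ε₀ := by linarith
  have h4 : dist y x < min ν ε₀ := by linarith
  rw [hU.value_eq hε (h3.trans_le (min_le_right _ _)) hy, EReal.coe_lt_coe_iff] at hlt
  exact ⟨ε, hε, h3.trans_le (min_le_left _ _), y, hy, h4.trans_le (min_le_left _ _), hlt⟩

/-- Changing the sign of `F` turns sup-inf into minus inf-sup. The two agree because the values are
given by the dynamic programming principle for `ε < ε₀`, hence the restriction to `ν < ε₀`. -/
lemma IsValueFamily.isLowerHalfRelaxedLimit_neg (hU : G.IsValueFamily ε₀ M U) {u : Eucl n → ℝ}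
    (hu : G.neg.IsUpperHalfRelaxedLimit u) : G.IsLowerHalfRelaxedLimit fun x => -u x := by
  intro x hx
  have h1 : Tendsto (fun ν : ℝ => -sSup (G.neg.nearbyValues x ν)) (𝓝[>] 0) (𝓝 (-(u x : EReal))) :=
    (continuous_neg.tendsto _).comp (hu x hx)
  rw [EReal.coe_neg]
  refine h1.congr' ?_
  filter_upwards [Ioo_mem_nhdsGT hU.pos] with ν hν
  have hv : ∀ (ε : ℝ) (hε : 0 < ε) (y : Eucl n), y ∈ closure G.Ω → ε ≤ ν →
      G.value hε y = -G.neg.value hε y := by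
    intro ε hε y hy hle
    have hlt := hle.trans_lt hν.2
    rw [hU.value_eq hε hlt hy, hU.neg.value_eq hε hlt hy, Pi.neg_apply, EReal.coe_neg, neg_neg]
  refine le_antisymm ?_ ?_
  · refine le_sInf ?_
    rintro _ ⟨ε, hε, y, hy, hd, rfl⟩
    rw [hv ε hε y hy (by linarith [dist_nonneg (x := y) (y := x)]), EReal.neg_le_neg_iff]
    exact le_sSup ⟨ε, hε, y, hy, hd, rfl⟩
  · rw [EReal.le_neg]
    refine sSup_le ?_
    rintro _ ⟨ε, hε, y, hy, hd, rfl⟩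
    rw [EReal.le_neg, ← hv ε hε y hy (by linarith [dist_nonneg (x := y) (y := x)])]
    exact sInf_le ⟨ε, hε, y, hy, hd, rfl⟩

end

end WeightedDirichletProblem

/-! ### The weighted p-Laplacian in nondivergence form -/

section Gradient

variable {n : ℕ} {φ : Eucl n → ℝ} {U : Set (Eucl n)}

lemma ContDiffOn.gradient_of_isOpen (hφ : ContDiffOn ℝ 2 φ U) (hU : IsOpen U) :
    ContDiffOn ℝ 1 (gradient φ) U := by
  rw [contDiffOn_euclidean]
  intro i
  have h1 : ContDiffOn ℝ 1 (fderiv ℝ φ) U := hφ.fderiv_of_isOpen hU (by norm_num)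
  have h2 : (fun x => gradient φ x i) = fun x => fderiv ℝ φ x (EuclideanSpace.single i 1) := by
    ext x
    rw [← inner_gradient_left, EuclideanSpace.inner_single_right]
    simp
  rw [h2]
  exact h1.clm_apply contDiffOn_const

/-- The derivative of `v ↦ |v|^q v`. -/
lemma hasFDerivAt_norm_rpow_smul_self {E : Type*} [NormedAddCommGroup E] [InnerProductSpace ℝ E]
    {q : ℝ} (hq : 0 < q) (v : E) :
    HasFDerivAt (fun w : E => ‖w‖ ^ q • w) (‖v‖ ^ q • ContinuousLinearMap.id ℝ E +
      ((q * ‖v‖ ^ (q - 2)) • innerSL ℝ v).smulRight v) v := by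
  by_cases hv : v = 0
  · subst hv
    have h0 : (0 : ℝ) ^ q = 0 := Real.zero_rpow hq.ne'
    simp only [norm_zero, map_zero, smul_zero, h0, zero_smul, ContinuousLinearMap.smulRight_zero,
      add_zero]
    refine .of_isLittleO ?_
    have h1 : (fun w : E => ‖w‖ ^ q) =o[𝓝 0] fun _ => (1 : ℝ) := by
      rw [Asymptotics.isLittleO_one_iff]
      have h := (continuousAt_id (x := (0 : E))).norm.rpow_const (p := q) (Or.inr hq.le)
      simpa [ContinuousAt, h0] using h
    have h2 := h1.smul_isBigO (Asymptotics.isBigO_refl (fun w : E => w) (𝓝 0))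
    simpa [h0] using h2
  · have h1 : HasFDerivAt (fun w : E => ‖w‖ ^ q) ((q * ‖v‖ ^ (q - 2)) • innerSL ℝ v) v := by
      apply HasStrictFDerivAt.hasFDerivAt
      convert! (hasStrictFDerivAt_norm_sq v).rpow_const (p := q / 2) (by simp [hv]) using 0
      simp_rw [← Real.rpow_natCast_mul (norm_nonneg _), ← Nat.cast_smul_eq_nsmul ℝ, smul_smul]
      ring_nf
    exact h1.smul (hasFDerivAt_id v)

/-- The trace of an endomorphism of Euclidean space, in coordinates. -/
noncomputable def coordTrace (B : Eucl n →L[ℝ] Eucl n) : ℝ :=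
  ∑ i, B (EuclideanSpace.single i 1) i

/-- The value of the weighted `p`-Laplacian of a function with gradient `v` and Hessian `B` at a
point where the weight has value `c` and gradient `g`. -/
noncomputable def pOperator (p c : ℝ) (g v : Eucl n) (B : Eucl n →L[ℝ] Eucl n) : ℝ :=
  ‖v‖ ^ (p - 2) * (c * coordTrace B + inner ℝ g v) +
    c * ((p - 2) * ‖v‖ ^ (p - 4)) * inner ℝ v (B v)

/-- The normalized operator: `pOperator` divided by `|v|^(p-2)`. -/
noncomputable def normalizedPOperator (p c : ℝ) (g v : Eucl n) (B : Eucl n →L[ℝ] Eucl n) : ℝ :=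
  c * (coordTrace B + (p - 2) * (inner ℝ v (B v) / ‖v‖ ^ 2)) + inner ℝ g v

lemma pOperator_eq_mul_normalized {p : ℝ} (c : ℝ) (g : Eucl n) {v : Eucl n} (hv : v ≠ 0)
    (B : Eucl n →L[ℝ] Eucl n) :
    pOperator p c g v B = ‖v‖ ^ (p - 2) * normalizedPOperator p c g v B := by
  have h : ‖v‖ ^ (p - 4) = ‖v‖ ^ (p - 2) / ‖v‖ ^ 2 := by
    rw [show p - 4 = p - 2 - (2 : ℕ) by push_cast; ring, Real.rpow_sub_natCast (norm_ne_zero_iff.2 hv)]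
  rw [pOperator, normalizedPOperator, h]
  ring

/-- The power `‖v‖ ^ (p - 4)` may be singular when `p < 4`, but it multiplies a quadratic form that
is zero at `v = 0`. -/
lemma pOperator_zero {p : ℝ} (hp : 2 < p) (c : ℝ) (g : Eucl n) (B : Eucl n →L[ℝ] Eucl n) :
    pOperator p c g 0 B = 0 := by
  have : (0 : ℝ) ^ (p - 2) = 0 := Real.zero_rpow (by linarith)
  simp [pOperator, this]

lemma abs_pOperator_le {p : ℝ} (hp : 2 < p) (c : ℝ) (g v : Eucl n) (B : Eucl n →L[ℝ] Eucl n) :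
    |pOperator p c g v B| ≤
      ‖v‖ ^ (p - 2) * (|c| * (|coordTrace B| + (p - 2) * ‖B‖) + ‖g‖ * ‖v‖) := by
  by_cases hv : v = 0
  · subst hv
    rw [pOperator_zero hp, abs_zero]
    have : 0 ≤ p - 2 := by linarith
    positivity
  · have hp2 : 0 ≤ p - 2 := by linarith
    have hn : 0 < ‖v‖ := norm_pos_iff.2 hv
    have h1 : |inner ℝ v (B v) / ‖v‖ ^ 2| ≤ ‖B‖ := by
      rw [abs_div, abs_of_pos (pow_pos hn 2), div_le_iff₀ (pow_pos hn 2)]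
      calc |inner ℝ v (B v)| ≤ ‖v‖ * ‖B v‖ := abs_real_inner_le_norm _ _
        _ ≤ ‖v‖ * (‖B‖ * ‖v‖) := by gcongr; exact B.le_opNorm v
        _ = _ := by ring
    rw [pOperator_eq_mul_normalized c g hv, abs_mul, abs_of_nonneg (by positivity),
      normalizedPOperator]
    gcongr
    calc _ ≤ |c * (coordTrace B + (p - 2) * (inner ℝ v (B v) / ‖v‖ ^ 2))| + |inner ℝ g v| :=
          abs_add_le _ _
      _ ≤ _ := by
        rw [abs_mul]
        gcongr
        · refine (abs_add_le _ _).trans ?_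
          rw [abs_mul, abs_of_nonneg hp2]
          gcongr
        · exact abs_real_inner_le_norm _ _

variable {ι : Type*} {l : Filter ι} {p c₀ : ℝ} {g₀ v₀ : Eucl n} {B₀ : Eucl n →L[ℝ] Eucl n}
  {c : ι → ℝ} {g v : ι → Eucl n} {B : ι → Eucl n →L[ℝ] Eucl n}

lemma tendsto_clm_apply {w : ι → Eucl n} {w₀ : Eucl n} (hB : Tendsto B l (𝓝 B₀))
    (hw : Tendsto w l (𝓝 w₀)) : Tendsto (fun i => B i (w i)) l (𝓝 (B₀ w₀)) :=
  (isBoundedBilinearMap_apply (𝕜 := ℝ) (E := Eucl n) (F := Eucl n)).continuous.continuousAt.tendsto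
    (x := (B₀, w₀)) |>.comp (hB.prodMk_nhds hw)

lemma tendsto_coordTrace (hB : Tendsto B l (𝓝 B₀)) :
    Tendsto (fun i => coordTrace (B i)) l (𝓝 (coordTrace B₀)) := by
  refine tendsto_finsetSum _ fun j _ => ?_
  exact ((EuclideanSpace.proj (𝕜 := ℝ) j).continuous.tendsto _).comp
    (tendsto_clm_apply hB tendsto_const_nhds)

lemma tendsto_normalizedPOperator (hv₀ : v₀ ≠ 0) (hc : Tendsto c l (𝓝 c₀))
    (hg : Tendsto g l (𝓝 g₀)) (hv : Tendsto v l (𝓝 v₀)) (hB : Tendsto B l (𝓝 B₀)) :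
    Tendsto (fun i => normalizedPOperator p (c i) (g i) (v i) (B i)) l
      (𝓝 (normalizedPOperator p c₀ g₀ v₀ B₀)) :=
  (hc.mul ((tendsto_coordTrace hB).add (((hv.inner (tendsto_clm_apply hB hv)).div (hv.norm.pow 2)
    (pow_ne_zero 2 (norm_ne_zero_iff.2 hv₀))).const_mul _))).add (hg.inner hv)

/-- At a nonzero limit gradient the normalized form is continuous; at zero the bound by `‖v‖ ^ (p -
2)` forces the limit. Continuity for all `p > 2` identifies the boundary operator. -/
lemma tendsto_pOperator (hp : 2 < p) (hc : Tendsto c l (𝓝 c₀))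
    (hg : Tendsto g l (𝓝 g₀)) (hv : Tendsto v l (𝓝 v₀)) (hB : Tendsto B l (𝓝 B₀)) :
    Tendsto (fun i => pOperator p (c i) (g i) (v i) (B i)) l
      (𝓝 (pOperator p c₀ g₀ v₀ B₀)) := by
  have hpow : Tendsto (fun i => ‖v i‖ ^ (p - 2)) l (𝓝 (‖v₀‖ ^ (p - 2))) :=
    hv.norm.rpow_const (Or.inr (by linarith))
  by_cases hv₀ : v₀ = 0
  · subst hv₀
    rw [pOperator_zero hp]
    refine squeeze_zero_norm (fun i => abs_pOperator_le hp _ _ _ _) ?_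
    have h0 : ‖(0 : Eucl n)‖ ^ (p - 2) = 0 := by rw [norm_zero, Real.zero_rpow (by linarith)]
    rw [h0] at hpow
    have h := hpow.mul ((hc.abs.mul ((tendsto_coordTrace hB).abs.add
      (hB.norm.const_mul (p - 2)))).add (hg.norm.mul hv.norm))
    simpa using h
  · rw [pOperator_eq_mul_normalized _ _ hv₀]
    refine (hpow.mul (tendsto_normalizedPOperator hv₀ hc hg hv hB)).congr' ?_
    filter_upwards [hv.eventually_ne hv₀] with i hi
    rw [pOperator_eq_mul_normalized _ _ hi]

end Gradient

namespace WeightedDirichletProblem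

noncomputable section

variable {n : ℕ} (G : WeightedDirichletProblem n) {φ : Eucl n → ℝ}

/-- The product rule, valid even at critical points of `φ` because `v ↦ ‖v‖ ^ (p - 2) • v` is
differentiable at zero. -/
lemma weightedPLaplacian_eq {x : Eucl n} (hx : x ∈ G.Ω)
    (hφ : DifferentiableAt ℝ (gradient φ) x) :
    G.weightedPLaplacian φ x =
      pOperator G.p (G.f x) (gradient G.f x) (gradient φ x) (fderiv ℝ (gradient φ) x) := by
  have hp := G.two_lt_p
  set v := gradient φ x with hv
  set B := fderiv ℝ (gradient φ) x with hB
  have hf : DifferentiableAt ℝ G.f x :=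
    (G.f_contDiffOn.contDiffAt (G.isOpen.mem_nhds hx)).differentiableAt (by norm_num)
  have hW := (hasFDerivAt_norm_rpow_smul_self (q := G.p - 2) (by linarith) v).comp x hφ.hasFDerivAt
  have hV := hf.hasFDerivAt.smul hW
  have hfun : (fun y => (G.f y * ‖gradient φ y‖ ^ (G.p - 2)) • gradient φ y) =
      G.f • ((fun w : Eucl n => ‖w‖ ^ (G.p - 2) • w) ∘ gradient φ) := by
    ext1 y
    rw [mul_smul]
    rfl
  have hsumv : ∀ T : Eucl n →L[ℝ] ℝ, ∑ i, T (EuclideanSpace.single i 1) * v i = T v := by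
    intro T
    conv_rhs => rw [← (EuclideanSpace.basisFun (Fin n) ℝ).sum_repr v]
    simp [mul_comm]
  rw [weightedPLaplacian, divergence, hfun, hV.fderiv, pOperator]
  have e4 : G.p - 2 - 2 = G.p - 4 := by ring
  have hterm : ∀ i : Fin n, (((G.f x • ((‖v‖ ^ (G.p - 2) • ContinuousLinearMap.id ℝ (Eucl n) +
      (((G.p - 2) * ‖v‖ ^ (G.p - 2 - 2)) • innerSL ℝ v).smulRight v) ∘L B) +
      (fderiv ℝ G.f x).smulRight (((fun w : Eucl n => ‖w‖ ^ (G.p - 2) • w) ∘ gradient φ) x))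
        (EuclideanSpace.single i 1) : Eucl n)) i =
      G.f x * (‖v‖ ^ (G.p - 2) * B (EuclideanSpace.single i 1) i) +
      G.f x * ((G.p - 2) * ‖v‖ ^ (G.p - 4)) *
        (((innerSL ℝ v) ∘L B) (EuclideanSpace.single i 1) * v i) +
      ‖v‖ ^ (G.p - 2) * (fderiv ℝ G.f x (EuclideanSpace.single i 1) * v i) := by
    intro i
    rw [e4]
    simp [← hv]
    ring
  rw [Finset.sum_congr rfl fun i _ => hterm i, Finset.sum_add_distrib, Finset.sum_add_distrib,
    ← Finset.mul_sum, ← Finset.mul_sum, ← Finset.mul_sum, ← Finset.mul_sum, hsumv, hsumv,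
    inner_gradient_left, coordTrace]
  simp
  ring

lemma IsTestFunction.differentiableAt_gradient {φ : Eucl n → ℝ} (hφ : G.IsTestFunction φ)
    {x : Eucl n} (hx : x ∈ closure G.Ω) :
    DifferentiableAt ℝ (gradient φ) x ∧ ContinuousAt (fderiv ℝ (gradient φ)) x := by
  obtain ⟨U, hU, hs, h⟩ := hφ
  have h1 := h.gradient_of_isOpen hU
  have hn := hU.mem_nhds (hs hx)
  refine ⟨(h1.contDiffAt hn).differentiableAt (by norm_num), ?_⟩
  exact (h1.continuousOn_fderiv_of_isOpen hU (by norm_num)).continuousAt hn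

lemma tendsto_weightedPLaplacian (hφ : G.IsTestFunction φ) {g : Eucl n → Eucl n}
    (hg : ContinuousOn g (closure G.Ω)) (hgf : ∀ x ∈ G.Ω, g x = gradient G.f x)
    {x : Eucl n} (hx : x ∈ closure G.Ω) :
    Tendsto (G.weightedPLaplacian φ) (𝓝[G.Ω] x)
      (𝓝 (pOperator G.p (G.f x) (g x) (gradient φ x) (fderiv ℝ (gradient φ) x))) := by
  obtain ⟨h1, h2⟩ := hφ.differentiableAt_gradient G hx
  refine Tendsto.congr' ?_ (tendsto_pOperator G.two_lt_p
    ((G.f_continuousOn_closure x hx).mono subset_closure)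
    ((hg x hx).mono subset_closure)
    (h1.continuousAt.mono_left nhdsWithin_le_nhds) (h2.mono_left nhdsWithin_le_nhds))
  filter_upwards [self_mem_nhdsWithin] with y hy
  rw [G.weightedPLaplacian_eq hy (hφ.differentiableAt_gradient G (subset_closure hy)).1, hgf y hy]

lemma weightedPLaplacianBoundary_eq (hφ : G.IsTestFunction φ) {g : Eucl n → Eucl n}
    (hg : ContinuousOn g (closure G.Ω)) (hgf : ∀ x ∈ G.Ω, g x = gradient G.f x)
    {x : Eucl n} (hx : x ∈ closure G.Ω) :
    G.weightedPLaplacianBoundary φ x =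
      pOperator G.p (G.f x) (g x) (gradient φ x) (fderiv ℝ (gradient φ) x) :=
  extendFrom_eq hx (G.tendsto_weightedPLaplacian hφ hg hgf hx)

lemma weightedPLaplacian_neg (φ : Eucl n → ℝ) (x : Eucl n) :
    G.weightedPLaplacian (fun y => -φ y) x = -G.weightedPLaplacian φ x := by
  have h1 : gradient (fun y => -φ y) = fun y => -gradient φ y := by
    ext1 y
    simp only [gradient, fderiv_fun_neg, map_neg]
  rw [weightedPLaplacian, weightedPLaplacian, h1]
  simp only [norm_neg, smul_neg, divergence, fderiv_fun_neg]
  simp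

end

end WeightedDirichletProblem

/-! ### Second moments of the uniform distribution on a ball -/

noncomputable section

section SecondMoments

variable {n : ℕ} {ε : ℝ}

lemma Continuous.integrableOn_ball_zero {g : Eucl n → ℝ} (hg : Continuous g) (ε : ℝ) :
    IntegrableOn g (Metric.ball 0 ε) :=
  (hg.continuousOn.integrableOn_compact (isCompact_closedBall 0 ε)).mono_set
    Metric.ball_subset_closedBall

lemma setIntegral_ball_comp_isometry (R : Eucl n ≃ₗᵢ[ℝ] Eucl n) (g : Eucl n → ℝ) :
    ∫ h in Metric.ball 0 ε, g (R h) = ∫ h in Metric.ball 0 ε, g h := by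
  have h := R.measurePreserving.setIntegral_preimage_emb R.toMeasurableEquiv.measurableEmbedding g
    (Metric.ball 0 ε)
  rwa [R.preimage_ball, map_zero] at h

lemma setIntegral_ball_linear (L : Eucl n →L[ℝ] ℝ) : ∫ h in Metric.ball 0 ε, L h = 0 := by
  have h := setIntegral_ball_comp_isometry (ε := ε) (LinearIsometryEquiv.neg ℝ) L
  simp only [LinearIsometryEquiv.coe_neg, map_neg, integral_neg] at h
  linarith

/-- Reflecting the single coordinate `i` changes the sign of the integrand. -/
lemma setIntegral_ball_mul_of_ne {i j : Fin n} (hij : i ≠ j) :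
    ∫ h : Eucl n in Metric.ball 0 ε, h i * h j = 0 := by
  set R : Eucl n ≃ₗᵢ[ℝ] Eucl n := LinearIsometryEquiv.piLpCongrRight 2 fun k =>
    if k = i then LinearIsometryEquiv.neg ℝ else LinearIsometryEquiv.refl ℝ ℝ with hR
  have h := setIntegral_ball_comp_isometry (ε := ε) R fun h => h i * h j
  have h2 : ∀ h : Eucl n, (R h) i * (R h) j = -(h i * h j) := fun h => by
    simp [hR, LinearIsometryEquiv.piLpCongrRight_apply, hij.symm]
  simp only [h2, integral_neg] at h
  linarith

lemma setIntegral_ball_sq_eq (i j : Fin n) :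
    ∫ h : Eucl n in Metric.ball 0 ε, h i * h i = ∫ h : Eucl n in Metric.ball 0 ε, h j * h j := by
  set R : Eucl n ≃ₗᵢ[ℝ] Eucl n :=
    LinearIsometryEquiv.piLpCongrLeft 2 ℝ ℝ (Equiv.swap i j) with hR
  have h := setIntegral_ball_comp_isometry (ε := ε) R fun h => h i * h i
  have h2 : ∀ h : Eucl n, (R h) i = h j := fun h => by
    simp [hR, LinearIsometryEquiv.piLpCongrLeft_apply, Equiv.piCongrLeft'_apply]
  simp only [h2] at h
  exact h.symm

lemma setIntegral_ball_norm_sq (hn : 0 < n) (hε : 0 < ε) :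
    ∫ h : Eucl n in Metric.ball 0 ε, ‖h‖ ^ 2 =
      n * (ε ^ 2 / (n + 2)) * volume.real (Metric.ball (0 : Eucl n) ε) := by
  have : Nontrivial (Eucl n) := by
    have : Nonempty (Fin n) := ⟨⟨0, hn⟩⟩
    infer_instance
  have h1 : ∫ h : Eucl n in Metric.ball 0 ε, ‖h‖ ^ 2 =
      ∫ h : Eucl n, (Set.Iio ε).indicator (fun r => r ^ 2) ‖h‖ := by
    rw [← integral_indicator Metric.isOpen_ball.measurableSet]
    congr 1 with h
    by_cases hh : ‖h‖ < ε <;> simp [Set.indicator, hh]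
  -- In polar coordinates the Jacobian `r ^ (n - 1)` and `r ^ 2` combine to `r ^ (n + 1)`; the
  -- truncated subtraction is exact because `0 < n`.
  have h2 : ∫ y in Set.Ioi (0 : ℝ), y ^ (n - 1) • (Set.Iio ε).indicator (fun r => r ^ 2) y =
      ε ^ (n + 2) / (n + 2) := by
    have h3 : ∀ y : ℝ, y ^ (n - 1) • (Set.Iio ε).indicator (fun r => r ^ 2) y =
        (Set.Iio ε).indicator (fun r => r ^ (n + 1)) y := by
      intro y
      by_cases hy : y < ε
      · simp only [Set.indicator, Set.mem_Iio, hy, if_true, smul_eq_mul, ← pow_add]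
        congr 1
        omega
      · simp [Set.indicator, hy]
    simp only [h3]
    rw [setIntegral_indicator measurableSet_Iio, Set.Ioi_inter_Iio, ← integral_Ioc_eq_integral_Ioo,
      ← intervalIntegral.integral_of_le hε.le, integral_pow]
    push_cast
    simp
    ring
  rw [h1, integral_fun_norm_addHaar, finrank_euclideanSpace_fin, h2, Measure.real, Measure.real,
    Measure.addHaar_ball volume 0 hε.le, ENNReal.toReal_mul, finrank_euclideanSpace_fin,
    ENNReal.toReal_ofReal (by positivity), nsmul_eq_mul, smul_eq_mul]
  ring

/-- Permuting coordinates shows that each carries one `n`-th of the integral of the squared norm. -/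
lemma setIntegral_ball_sq (hε : 0 < ε) (i : Fin n) :
    ∫ h : Eucl n in Metric.ball 0 ε, h i * h i =
      ε ^ 2 / (n + 2) * volume.real (Metric.ball (0 : Eucl n) ε) := by
  have hn : 0 < n := i.pos
  have h1 : ∫ h : Eucl n in Metric.ball 0 ε, ‖h‖ ^ 2 =
      n * ∫ h : Eucl n in Metric.ball 0 ε, h i * h i := by
    have h2 : ∀ h : Eucl n, ‖h‖ ^ 2 = ∑ j, h j * h j := fun h => by
      rw [EuclideanSpace.real_norm_sq_eq]
      simp [sq]
    simp only [h2]
    rw [integral_finsetSum _ fun j _ => Continuous.integrableOn_ball_zero (by fun_prop) ε,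
      Finset.sum_congr rfl fun j _ => setIntegral_ball_sq_eq j i]
    simp
  rw [setIntegral_ball_norm_sq hn hε, mul_assoc] at h1
  exact (mul_left_cancel₀ (by positivity) h1).symm

lemma setIntegral_ball_quadratic (hε : 0 < ε) (B : Eucl n →L[ℝ] Eucl n) :
    ∫ h : Eucl n in Metric.ball 0 ε, inner ℝ (B h) h =
      ε ^ 2 / (n + 2) * coordTrace B * volume.real (Metric.ball (0 : Eucl n) ε) := by
  have h1 : ∀ h : Eucl n, inner ℝ (B h) h =
      ∑ i, ∑ j, B (EuclideanSpace.single j 1) i * (h j * h i) := by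
    intro h
    have h2 : B h = ∑ j, h j • B (EuclideanSpace.single j 1) := by
      conv_lhs => rw [← (EuclideanSpace.basisFun (Fin n) ℝ).sum_repr h]
      simp
    rw [h2, PiLp.inner_apply]
    refine Finset.sum_congr rfl fun i _ => ?_
    simp only [WithLp.ofLp_sum, Finset.sum_apply, PiLp.smul_apply, smul_eq_mul,
      RCLike.inner_apply, conj_trivial, Finset.mul_sum]
    exact Finset.sum_congr rfl fun j _ => by ring
  simp only [h1]
  rw [integral_finsetSum _ fun i _ => Continuous.integrableOn_ball_zero (by fun_prop) ε, coordTrace,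
    Finset.mul_sum, Finset.sum_mul]
  refine Finset.sum_congr rfl fun i _ => ?_
  rw [integral_finsetSum _ fun j _ => Continuous.integrableOn_ball_zero (by fun_prop) ε,
    Finset.sum_eq_single i]
  · rw [integral_const_mul, setIntegral_ball_sq hε]
    ring
  · intro j _ hj
    rw [integral_const_mul, setIntegral_ball_mul_of_ne hj, mul_zero]
  · simp

end SecondMoments

namespace WeightedDirichletProblem

variable {n : ℕ}

lemma integral_uniformBall (ε : ℝ) (x : Eucl n) (g : Eucl n → ℝ) :
    ∫ y, g (y - x) ∂(uniformBall ε x) =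
      (volume.real (Metric.ball (0 : Eucl n) ε))⁻¹ * ∫ h in Metric.ball 0 ε, g h := by
  rw [uniformBall, integral_smul_measure, Measure.addHaar_ball_center, ENNReal.toReal_inv,
    smul_eq_mul, Measure.real, ← integral_indicator Metric.isOpen_ball.measurableSet,
    ← integral_indicator Metric.isOpen_ball.measurableSet,
    ← integral_sub_right_eq_self ((Metric.ball 0 ε).indicator g) x]
  congr 2 with y
  simp [Set.indicator, dist_eq_norm]

/-- The mean value over a ball of a quadratic polynomial. -/
lemma integral_uniformBall_quadratic {ε : ℝ} (hε : 0 < ε) (x : Eucl n) (a : ℝ) (v : Eucl n)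
    (B : Eucl n →L[ℝ] Eucl n) :
    ∫ y, (a + inner ℝ v (y - x) + inner ℝ (B (y - x)) (y - x) / 2) ∂(uniformBall ε x) =
      a + ε ^ 2 / (2 * (n + 2)) * coordTrace B := by
  rw [integral_uniformBall ε x fun h => a + inner ℝ v h + inner ℝ (B h) h / 2]
  have hvol : volume.real (Metric.ball (0 : Eucl n) ε) ≠ 0 :=
    (ENNReal.toReal_pos (Metric.measure_ball_pos volume _ hε).ne' measure_ball_lt_top.ne).ne'
  have i1 : IntegrableOn (fun h : Eucl n => a + inner ℝ v h) (Metric.ball 0 ε) :=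
    Continuous.integrableOn_ball_zero (by fun_prop) ε
  have i2 : IntegrableOn (fun h : Eucl n => inner ℝ (B h) h / 2) (Metric.ball 0 ε) :=
    Continuous.integrableOn_ball_zero (by fun_prop) ε
  have i3 : IntegrableOn (fun h : Eucl n => inner ℝ v h) (Metric.ball 0 ε) :=
    Continuous.integrableOn_ball_zero (by fun_prop) ε
  have i4 : IntegrableOn (fun _ : Eucl n => a) (Metric.ball 0 ε) :=
    Continuous.integrableOn_ball_zero (by fun_prop) ε
  rw [integral_add i1 i2, integral_add i4 i3, integral_div, setIntegral_ball_quadratic hε,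
    setIntegral_const, smul_eq_mul,
    show ∫ h : Eucl n in Metric.ball 0 ε, inner ℝ v h = 0 from
      setIntegral_ball_linear (innerSL ℝ v)]
  field_simp
  ring

end WeightedDirichletProblem

end

/-! ### Taylor expansion and consistency of the dynamic programming principle -/

namespace WeightedDirichletProblem

noncomputable section

section Taylor

variable {n : ℕ} {φ : Eucl n → ℝ}

/-- Second order Taylor formula with frozen Hessian. -/
lemma abs_taylor_two_le {s : Set (Eucl n)} (hs : Convex ℝ s)
    (hφ : ∀ z ∈ s, DifferentiableAt ℝ φ z) (hφ' : ∀ z ∈ s, DifferentiableAt ℝ (gradient φ) z)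
    {B : Eucl n →L[ℝ] Eucl n} {w : ℝ} (hB : ∀ z ∈ s, ‖fderiv ℝ (gradient φ) z - B‖ ≤ w)
    {x h : Eucl n} (hx : x ∈ s) (hxh : x + h ∈ s) :
    |φ (x + h) - (φ x + inner ℝ (gradient φ x) h + inner ℝ (B h) h / 2)| ≤ w * ‖h‖ ^ 2 := by
  have hmem : ∀ t ∈ Set.Icc (0 : ℝ) 1, x + t • h ∈ s := fun t ht => by
    have := hs.add_smul_sub_mem hx hxh ht
    simpa using this
  have hline : ∀ t : ℝ, HasDerivAt (fun t : ℝ => x + t • h) h t := fun t => by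
    simpa using ((hasDerivAt_id t).smul_const h).const_add x
  -- Along the segment, the derivative of the remainder is the gradient increment minus its
  -- linearization by `B`, paired with `h`; two mean value inequalities finish.
  set ψ : ℝ → ℝ := fun t => φ (x + t • h) - (t * inner ℝ (gradient φ x) h +
    t ^ 2 * (inner ℝ (B h) h / 2)) with hψ
  have hd : ∀ t ∈ Set.Icc (0 : ℝ) 1, HasDerivWithinAt ψ
      (inner ℝ (gradient φ (x + t • h) - gradient φ x - B (t • h)) h) (Set.Icc 0 1) t := by
    intro t ht
    have h1 : HasDerivAt (fun t : ℝ => φ (x + t • h)) (fderiv ℝ φ (x + t • h) h) t :=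
      (hφ _ (hmem t ht)).hasFDerivAt.comp_hasDerivAt t (hline t)
    have h2 : HasDerivAt (fun t : ℝ => t * inner ℝ (gradient φ x) h + t ^ 2 * (inner ℝ (B h) h / 2))
        (1 * inner ℝ (gradient φ x) h + (2 * t) * (inner ℝ (B h) h / 2)) t := by
      refine ((hasDerivAt_id t).mul_const _).add (HasDerivAt.mul_const ?_ _)
      simpa using hasDerivAt_pow 2 t
    refine ((h1.sub h2).congr_deriv ?_).hasDerivWithinAt
    simp only [inner_sub_left, inner_gradient_left, map_smul, real_inner_smul_left]
    ring
  have hbound : ∀ t ∈ Set.Icc (0 : ℝ) 1,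
      ‖inner ℝ (gradient φ (x + t • h) - gradient φ x - B (t • h)) h‖ ≤ w * ‖h‖ ^ 2 := by
    intro t ht
    have h1 := hs.norm_image_sub_le_of_norm_fderiv_le' (𝕜 := ℝ) hφ' hB hx (hmem t ht)
    rw [add_sub_cancel_left] at h1
    have hw : 0 ≤ w := (norm_nonneg _).trans (hB x hx)
    calc _ ≤ ‖gradient φ (x + t • h) - gradient φ x - B (t • h)‖ * ‖h‖ := norm_inner_le_norm _ _
      _ ≤ w * ‖t • h‖ * ‖h‖ := by gcongr
      _ = w * (t * ‖h‖) * ‖h‖ := by rw [norm_smul, Real.norm_of_nonneg ht.1]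
      _ ≤ w * (1 * ‖h‖) * ‖h‖ := by gcongr; exact ht.2
      _ = _ := by ring
  have key := (convex_Icc (0 : ℝ) 1).norm_image_sub_le_of_norm_hasDerivWithin_le hd hbound
    (Set.left_mem_Icc.2 zero_le_one) (Set.right_mem_Icc.2 zero_le_one)
  have e : ψ 1 - ψ 0 = φ (x + h) - (φ x + inner ℝ (gradient φ x) h + inner ℝ (B h) h / 2) := by
    simp [hψ]
    ring
  rw [e] at key
  simpa using key

/-- A linear function plus a quadratic form is almost maximal on a small ball in the direction of
the linear part. -/
lemma inner_add_quadratic_le {ε : ℝ} (hε : 0 < ε) {v h : Eucl n} (hv : v ≠ 0) (hh : ‖h‖ ≤ ε)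
    (B : Eucl n →L[ℝ] Eucl n) :
    inner ℝ v h + inner ℝ (B h) h / 2 ≤
      ε * ‖v‖ + ε ^ 2 / 2 * (inner ℝ v (B v) / ‖v‖ ^ 2) + ε ^ 3 * (‖B‖ ^ 2 / ‖v‖) / 2 := by
  have hn : 0 < ‖v‖ := norm_pos_iff.2 hv
  -- The maximizer of the linear part on the closed ball. Moving from `w` to `h` loses `‖v‖ * ‖h -
  -- w‖ ^ 2 / (2 * ε)` in the linear part, which absorbs the first-order gain of the quadratic form.
  set w := (ε / ‖v‖) • v with hw
  have hwn : ‖w‖ = ε := by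
    rw [hw, norm_smul, Real.norm_of_nonneg (by positivity)]
    field_simp
  have h1 : ‖h - w‖ ^ 2 ≤ 2 * ε ^ 2 - 2 * (ε / ‖v‖ * inner ℝ v h) := by
    rw [norm_sub_sq_real, hwn, hw, real_inner_smul_right, real_inner_comm h v]
    have := pow_le_pow_left₀ (norm_nonneg h) hh 2
    linarith
  have h2 : inner ℝ v h ≤ ‖v‖ * ε - ‖v‖ * ‖h - w‖ ^ 2 / (2 * ε) := by
    have h3 : inner ℝ v h = ‖v‖ / ε * (ε / ‖v‖ * inner ℝ v h) := by field_simp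
    calc inner ℝ v h = ‖v‖ / ε * (ε / ‖v‖ * inner ℝ v h) := h3
      _ ≤ ‖v‖ / ε * (ε ^ 2 - ‖h - w‖ ^ 2 / 2) :=
        mul_le_mul_of_nonneg_left (by linarith) (by positivity)
      _ = _ := by field_simp
  have h4 : inner ℝ (B w) w = ε ^ 2 * (inner ℝ v (B v) / ‖v‖ ^ 2) := by
    rw [hw, map_smul, real_inner_smul_left, real_inner_smul_right, real_inner_comm]
    field_simp
  have h5 : inner ℝ (B h) h - inner ℝ (B w) w ≤ 2 * (‖B‖ * ‖h - w‖ * ε) := by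
    have h6 : inner ℝ (B h) h - inner ℝ (B w) w = inner ℝ (B (h - w)) h + inner ℝ (B w) (h - w) := by
      rw [map_sub, inner_sub_left, inner_sub_right]
      ring
    have h7 : inner ℝ (B (h - w)) h ≤ ‖B‖ * ‖h - w‖ * ε :=
      (real_inner_le_norm _ _).trans (mul_le_mul (B.le_opNorm _) hh (norm_nonneg _) (by positivity))
    have h8 : inner ℝ (B w) (h - w) ≤ ‖B‖ * ‖h - w‖ * ε := by
      refine (real_inner_le_norm _ _).trans ?_
      calc ‖B w‖ * ‖h - w‖ ≤ ‖B‖ * ‖w‖ * ‖h - w‖ := by gcongr; exact B.le_opNorm w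
        _ = _ := by rw [hwn]; ring
    linarith
  -- Completion of the square.
  have h9 : ‖B‖ * ‖h - w‖ * ε - ‖v‖ * ‖h - w‖ ^ 2 / (2 * ε) ≤ ε ^ 3 * (‖B‖ ^ 2 / ‖v‖) / 2 := by
    have h10 : ε ^ 3 * (‖B‖ ^ 2 / ‖v‖) / 2 -
        (‖B‖ * ‖h - w‖ * ε - ‖v‖ * ‖h - w‖ ^ 2 / (2 * ε)) =
        (ε ^ 2 * ‖B‖ - ‖v‖ * ‖h - w‖) ^ 2 / (2 * ε * ‖v‖) := by
      field_simp
      ring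
    have h11 : 0 ≤ (ε ^ 2 * ‖B‖ - ‖v‖ * ‖h - w‖) ^ 2 / (2 * ε * ‖v‖) := by positivity
    linarith
  linarith

end Taylor

variable {n : ℕ} {G : WeightedDirichletProblem n}

variable (G) in
/-- The denominator in the definition of `γ`. -/
def gammaDenom (x : Eucl n) : ℝ := ‖gradient G.f x‖ / (2 * (G.p + n)) + G.f x

lemma gammaDenom_pos {x : Eucl n} (hx : x ∈ G.Ω) : 0 < G.gammaDenom x := by
  have h1 := G.f_pos hx
  have h2 := G.p_add_pos
  unfold gammaDenom
  positivity

variable (G) in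
lemma exists_gammaDenom_le : ∃ D : ℝ, 0 < D ∧ ∀ x ∈ G.Ω, G.gammaDenom x ≤ D := by
  obtain ⟨D, hD, hgD⟩ := G.exists_norm_gradient_le
  obtain ⟨c, C, hc, hf⟩ := G.f_bounds
  have hp := G.p_add_pos
  obtain ⟨x, hx⟩ := G.isConnected.nonempty
  have hC : 0 < C := hc.trans_le ((hf x hx).1.trans (hf x hx).2)
  refine ⟨D / (2 * (G.p + n)) + C, by positivity, fun x hx => ?_⟩
  unfold gammaDenom
  have := hgD x hx
  gcongr
  exact (hf x hx).2

/-- A solution of the dynamic programming principle which is below a quadratic polynomial near `x`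
is at `x` below the polynomial plus the normalized operator. -/
lemma IsDPPSolution.le_of_le_quadratic {ε M : ℝ} {V : Eucl n → ℝ} (hV : G.IsDPPSolution ε M V)
    (hε : 0 < ε) (hε1 : ε ≤ 1) {x : Eucl n} (hx : x ∈ G.Ω) {a : ℝ} {v : Eucl n} (hv : v ≠ 0)
    {B : Eucl n →L[ℝ] Eucl n}
    (h : ∀ y, dist y x ≤ ε → V y ≤ a + inner ℝ v (y - x) + inner ℝ (B (y - x)) (y - x) / 2) :
    V x ≤ a + ε ^ 2 * (normalizedPOperator G.p (G.f x) (gradient G.f x) v B /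
      (2 * (G.p + n) * G.gammaDenom x)) + ε ^ 3 * (‖B‖ ^ 2 / ‖v‖ + ‖B‖) := by
  have : Fact (0 < ε) := ⟨hε⟩
  have hn : 0 < ‖v‖ := norm_pos_iff.2 hv
  set κ := inner ℝ v (B v) / ‖v‖ ^ 2 with hκ
  have hsup : localSup ε V x ≤ a + ε * ‖v‖ + ε ^ 2 / 2 * κ + ε ^ 3 * (‖B‖ ^ 2 / ‖v‖) / 2 := by
    refine localSup_le hε fun y hy => ?_
    have h1 := h y (Metric.mem_ball.1 hy).le
    have h2 := inner_add_quadratic_le hε hv (h := y - x)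
      (by rw [← dist_eq_norm]; exact (Metric.mem_ball.1 hy).le) B
    linarith
  have hinf : localInf ε V x ≤ a - ε * ‖v‖ + ε ^ 2 / 2 * κ := by
    -- The point opposite to the gradient at distance exactly `ε` is not in the open ball; it is
    -- approached from inside as `s → 1`.
    have hc : Tendsto (fun s : ℝ => a - s * (ε * ‖v‖) + s ^ 2 * (ε ^ 2 / 2 * κ)) (𝓝[<] 1)
        (𝓝 (a - 1 * (ε * ‖v‖) + 1 ^ 2 * (ε ^ 2 / 2 * κ))) := by
      have : Continuous fun s : ℝ => a - s * (ε * ‖v‖) + s ^ 2 * (ε ^ 2 / 2 * κ) := by fun_prop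
      exact (this.tendsto 1).mono_left nhdsWithin_le_nhds
    rw [one_mul, one_pow, one_mul] at hc
    refine ge_of_tendsto hc ?_
    filter_upwards [Ioo_mem_nhdsLT (zero_lt_one' ℝ)] with s hs
    have hd : ‖(-(s * (ε / ‖v‖))) • v‖ = s * ε := by
      rw [norm_smul, norm_neg, Real.norm_of_nonneg (mul_nonneg hs.1.le (by positivity))]
      field_simp
    have hdist : dist (x + (-(s * (ε / ‖v‖))) • v) x = s * ε := by
      rw [dist_eq_norm, add_sub_cancel_left, hd]
    have hlt : s * ε < ε := by nlinarith [hs.2]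
    refine (localInf_le hV.bound (Metric.mem_ball.2 (hdist.trans_lt hlt))).trans
      ((h _ (hdist.trans_lt hlt).le).trans (le_of_eq ?_))
    rw [add_sub_cancel_left, map_smul, real_inner_smul_right, real_inner_smul_right,
      real_inner_smul_left, real_inner_self_eq_norm_sq, real_inner_comm, hκ]
    field_simp
    ring
  have hmean : ∫ y, V y ∂(uniformBall ε x) ≤ a + ε ^ 2 / (2 * (n + 2)) * coordTrace B := by
    rw [← integral_uniformBall_quadratic hε x a v B]
    refine integral_mono_ae (Integrable.of_bound hV.measurable.aestronglyMeasurable M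
      (ae_of_all _ hV.bound)) ?_ ((ae_uniformBall ε x).mono fun y hy =>
        h y (Metric.mem_ball.1 hy).le)
    refine Integrable.of_bound (C := |a| + ‖v‖ * ε + ‖B‖ * ε * ε / 2)
      (Continuous.aestronglyMeasurable (by fun_prop)) ((ae_uniformBall ε x).mono fun y hy => ?_)
    have hy' : ‖y - x‖ ≤ ε := by rw [← dist_eq_norm]; exact (Metric.mem_ball.1 hy).le
    refine (norm_add_le _ _).trans (add_le_add ((norm_add_le _ _).trans (add_le_add le_rfl ?_)) ?_)
    · exact (norm_inner_le_norm _ _).trans (by gcongr)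
    · rw [norm_div, Real.norm_of_nonneg (zero_le_two (α := ℝ))]
      refine div_le_div_of_nonneg_right ((norm_inner_le_norm _ _).trans ?_) zero_le_two
      exact mul_le_mul ((B.le_opNorm _).trans (by gcongr)) hy' (norm_nonneg _) (by positivity)
  have hshift : V (G.shift ε x) ≤
      a + ε ^ 2 * (inner ℝ (gradient G.f x) v / ‖gradient G.f x‖) + ε ^ 3 * ‖B‖ / 2 := by
    have hd := G.dist_shift_le (ε := ε) x
    have hle : ε ^ 2 ≤ ε := by nlinarith
    refine (h _ (hd.trans hle)).trans ?_
    have e1 : inner ℝ v (G.shift ε x - x) =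
        ε ^ 2 * (inner ℝ (gradient G.f x) v / ‖gradient G.f x‖) := by
      rw [shift, add_sub_cancel_left, real_inner_smul_right, real_inner_comm]
      ring
    have e2 : inner ℝ (B (G.shift ε x - x)) (G.shift ε x - x) ≤ ε ^ 3 * ‖B‖ := by
      rw [dist_eq_norm] at hd
      calc _ ≤ ‖B (G.shift ε x - x)‖ * ‖G.shift ε x - x‖ := real_inner_le_norm _ _
        _ ≤ ‖B‖ * ε * ε ^ 2 :=
          mul_le_mul ((B.le_opNorm _).trans (mul_le_mul_of_nonneg_left (hd.trans hle)
            (norm_nonneg _))) hd (norm_nonneg _) (by positivity)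
        _ = _ := by ring
    rw [e1]
    linarith
  have hα := G.alpha_nonneg
  have hβ := G.beta_nonneg
  have hγ := G.gamma_nonneg hx
  have hγ1 := G.gamma_le_one hx
  have hγ' := sub_nonneg.2 hγ1
  have hα1 : G.alpha ≤ 1 := by
    have : G.beta = 1 - G.alpha := rfl
    linarith
  have hp := G.p_add_pos
  have hD := gammaDenom_pos hx
  have hβe : G.beta = (n + 2) / (G.p + n) := by
    unfold beta alpha
    field_simp
    ring
  have hγe : G.gamma x = G.f x / G.gammaDenom x := rfl
  -- `1 - γ` is proportional to `‖Df‖`, which cancels the normalization of the drift direction; if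
  -- `Df = 0`, both sides vanish.
  have hδe : (1 - G.gamma x) * (inner ℝ (gradient G.f x) v / ‖gradient G.f x‖) =
      inner ℝ (gradient G.f x) v / (2 * (G.p + n) * G.gammaDenom x) := by
    by_cases h0 : gradient G.f x = 0
    · simp [h0]
    · have h0' : ‖gradient G.f x‖ ≠ 0 := norm_ne_zero_iff.2 h0
      have : 1 - G.gamma x = ‖gradient G.f x‖ / (2 * (G.p + n)) / G.gammaDenom x := by
        rw [hγe, eq_div_iff hD.ne', sub_mul, div_mul_cancel₀ _ hD.ne', gammaDenom]
        ring
      rw [this]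
      field_simp
  -- Here the weights match: `α / 2 = (p - 2) / (2 * (p + n))` and `β / (2 * (n + 2)) = 1 / (2 * (p
  -- + n))`, while `γ` supplies `f` over the common denominator.
  have hmain : G.gamma x * (G.alpha / 2 * (ε ^ 2 * κ) +
      G.beta * (ε ^ 2 / (2 * (n + 2)) * coordTrace B)) +
      (1 - G.gamma x) * (ε ^ 2 * (inner ℝ (gradient G.f x) v / ‖gradient G.f x‖)) =
      ε ^ 2 * (normalizedPOperator G.p (G.f x) (gradient G.f x) v B /
      (2 * (G.p + n) * G.gammaDenom x)) := by
    have : (1 - G.gamma x) * (ε ^ 2 * (inner ℝ (gradient G.f x) v / ‖gradient G.f x‖)) =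
        ε ^ 2 * (inner ℝ (gradient G.f x) v / (2 * (G.p + n) * G.gammaDenom x)) := by
      rw [← hδe]; ring
    rw [this, hβe, hγe, alpha, normalizedPOperator, ← hκ]
    field_simp
    ring
  have herr1 : G.gamma x * (G.alpha / 2) * (ε ^ 3 * (‖B‖ ^ 2 / ‖v‖) / 2) ≤
      1 * (ε ^ 3 * (‖B‖ ^ 2 / ‖v‖)) := by
    have h1 : G.gamma x * (G.alpha / 2) ≤ 1 := mul_le_one₀ hγ1 (by positivity) (by linarith)
    have h2 : 0 ≤ ε ^ 3 * (‖B‖ ^ 2 / ‖v‖) := by positivity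
    exact mul_le_mul h1 (by linarith) (by linarith) zero_le_one
  have herr2 : (1 - G.gamma x) * (ε ^ 3 * ‖B‖ / 2) ≤ 1 * (ε ^ 3 * ‖B‖) := by
    have h2 : 0 ≤ ε ^ 3 * ‖B‖ := by positivity
    exact mul_le_mul (by linarith) (by linarith) (by linarith) zero_le_one
  rw [hV.eq_dppMean x hx]
  calc G.dppMean ε V x ≤ G.gamma x * (G.alpha / 2 *
        ((a + ε * ‖v‖ + ε ^ 2 / 2 * κ + ε ^ 3 * (‖B‖ ^ 2 / ‖v‖) / 2) +
          (a - ε * ‖v‖ + ε ^ 2 / 2 * κ)) + G.beta * (a + ε ^ 2 / (2 * (n + 2)) * coordTrace B)) +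
        (1 - G.gamma x) *
          (a + ε ^ 2 * (inner ℝ (gradient G.f x) v / ‖gradient G.f x‖) + ε ^ 3 * ‖B‖ / 2) := by
        unfold dppMean
        gcongr
    _ = a + (G.gamma x * (G.alpha / 2 * (ε ^ 2 * κ) +
      G.beta * (ε ^ 2 / (2 * (n + 2)) * coordTrace B)) +
      (1 - G.gamma x) * (ε ^ 2 * (inner ℝ (gradient G.f x) v / ‖gradient G.f x‖))) +
      (G.gamma x * (G.alpha / 2) * (ε ^ 3 * (‖B‖ ^ 2 / ‖v‖) / 2) +
        (1 - G.gamma x) * (ε ^ 3 * ‖B‖ / 2)) := by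
        have : G.beta = 1 - G.alpha := rfl
        rw [this]
        ring
    _ ≤ _ := by
        rw [hmain]
        linarith

end

end WeightedDirichletProblem

/-! ### Viscosity inequalities for the half-relaxed limits -/

namespace WeightedDirichletProblem

noncomputable section

variable {n : ℕ} {G : WeightedDirichletProblem n} {ε₀ M : ℝ} {U : ℝ → Eucl n → ℝ}
  {u φ : Eucl n → ℝ}

lemma IsTestFunction.continuousAt (hφ : G.IsTestFunction φ) {x : Eucl n} (hx : x ∈ closure G.Ω) :
    ContinuousAt φ x := by
  obtain ⟨O, hO, hs, h⟩ := hφ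
  exact h.continuousOn.continuousAt (hO.mem_nhds (hs hx))

/-- The boundary values are below the upper half-relaxed limit. -/
lemma IsValueFamily.F_le (hU : G.IsValueFamily ε₀ M U) (hu : G.IsUpperHalfRelaxedLimit u)
    {x : Eucl n} (hx : x ∈ frontier G.Ω) : G.F x ≤ u x := by
  refine le_of_forall_gt fun c hc => ?_
  obtain ⟨ν, hν, h⟩ := hU.exists_forall_lt hu (frontier_subset_closure hx) hc
  have hpos : 0 < min ν ε₀ / 2 := half_pos (lt_min hν hU.pos)
  have h1 : min ν ε₀ / 2 < min ν ε₀ := half_lt_self (lt_min hν hU.pos)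
  -- Frontier points lie in the strip, so the game stops there at once with value `F`.
  rw [← (hU.isDPPSolution _ hpos (h1.trans_le (min_le_right _ _))).eq_F x
    (G.frontier_subset_outerStrip hpos hx)]
  exact h _ hpos (h1.trans_le (min_le_left _ _)) x (frontier_subset_closure hx) (by simpa using hν)

/-- On thin strips the boundary values are uniformly below a function which is above them on the
boundary. -/
lemma exists_outerStrip_sub_le (hφ : G.IsTestFunction φ) (h : ∀ x ∈ frontier G.Ω, G.F x < φ x) :
    ∃ η > 0, ∀ ε ≤ η, ∀ y ∈ G.outerStrip ε, G.F y - φ y ≤ -η := by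
  obtain ⟨O, hO, hs, hφO⟩ := hφ
  obtain ⟨V, hV, hVs, hF⟩ := G.F_continuous_near_boundary
  have hc : ContinuousOn (fun y => G.F y - φ y) (V ∩ O) :=
    (hF.mono Set.inter_subset_left).sub (hφO.continuousOn.mono Set.inter_subset_right)
  have hW := hc.isOpen_inter_preimage (hV.inter hO) (isOpen_Iio (a := (0 : ℝ)))
  obtain ⟨δ, hδ, hsub, hstrip⟩ := G.exists_outerStrip_subset hW fun x hx =>
    ⟨⟨hVs hx, hs (frontier_subset_closure hx)⟩, sub_neg.2 (h x hx)⟩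
  -- Compactness of the closed thickening of the frontier turns the pointwise strict inequality into
  -- a uniform gap.
  obtain ⟨z, hz, hmax⟩ := (G.isCompact_frontier.cthickening (r := δ)).exists_isMaxOn
    (G.frontier_nonempty.mono (Metric.self_subset_cthickening _))
    (hc.mono (hsub.trans Set.inter_subset_left))
  have hneg : G.F z - φ z < 0 := (hsub hz).2
  refine ⟨min δ (-(G.F z - φ z)), lt_min hδ (neg_pos.2 hneg), fun ε hε y hy => ?_⟩
  have h1 : G.F y - φ y ≤ G.F z - φ z := hmax (hstrip ε (hε.trans (min_le_left _ _)) hy)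
  have h2 := min_le_right δ (-(G.F z - φ z))
  linarith

/-- Away from the touching point the values with small steps are uniformly below the test
function. -/
lemma IsValueFamily.exists_sub_le (hU : G.IsValueFamily ε₀ M U) (hu : G.IsUpperHalfRelaxedLimit u)
    (hφ : G.IsTestFunction φ) {K : Set (Eucl n)} (hK : IsCompact K) (hKs : K ⊆ closure G.Ω)
    (h : ∀ x ∈ K, u x < φ x) :
    ∃ η > 0, ∀ ε, 0 < ε → ε < η → ∀ y ∈ K, U ε y - φ y ≤ -η := by
  refine hK.induction_on (p := fun S => ∃ η > 0, ∀ ε, 0 < ε → ε < η → ∀ y ∈ S, U ε y - φ y ≤ -η)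
    ⟨1, one_pos, by simp⟩ ?_ ?_ ?_
  · rintro S T hST ⟨η, hη, h1⟩
    exact ⟨η, hη, fun ε h0 h2 y hy => h1 ε h0 h2 y (hST hy)⟩
  · rintro S T ⟨η, hη, h1⟩ ⟨η', hη', h1'⟩
    refine ⟨min η η', lt_min hη hη', fun ε h0 h2 y hy => ?_⟩
    rcases hy with hy | hy
    · exact (h1 ε h0 (h2.trans_le (min_le_left _ _)) y hy).trans (neg_le_neg (min_le_left _ _))
    · exact (h1' ε h0 (h2.trans_le (min_le_right _ _)) y hy).trans (neg_le_neg (min_le_right _ _))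
  · intro x hx
    have hgap := h x hx
    set d := φ x - u x with hd
    have hd0 : 0 < d := sub_pos.2 hgap
    obtain ⟨ν, hν, h1⟩ := hU.exists_forall_lt hu (hKs hx) (c := u x + d / 2) (by linarith)
    have h2 : ∀ᶠ y in 𝓝 x, φ x - d / 4 < φ y :=
      (hφ.continuousAt (hKs hx)).eventually_const_lt (by linarith)
    refine ⟨{y | y ∈ K ∧ φ x - d / 4 < φ y ∧ dist y x < ν}, ?_, min ν (d / 4),
      lt_min hν (by linarith), fun ε h0 h3 y hy => ?_⟩
    · filter_upwards [self_mem_nhdsWithin, mem_nhdsWithin_of_mem_nhds h2,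
        mem_nhdsWithin_of_mem_nhds (Metric.ball_mem_nhds x hν)] with y hy1 hy2 hy3
      exact ⟨hy1, hy2, hy3⟩
    · obtain ⟨hy1, hy2, hy3⟩ := hy
      have h4 := h1 ε h0 (h3.trans_le (min_le_left _ _)) y (hKs hy1) hy3
      have h5 := min_le_right ν (d / 4)
      linarith

/-- A test function touching the upper half-relaxed limit from above, at a point where the boundary
condition is not attained, has a nonnegative normalized operator. -/
theorem IsValueFamily.normalizedPOperator_nonneg (hU : G.IsValueFamily ε₀ M U)
    (hu : G.IsUpperHalfRelaxedLimit u) (hφ : G.IsTestFunction φ) {x₀ : Eucl n}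
    (hx₀ : x₀ ∈ closure G.Ω) (heq : φ x₀ = u x₀) (hlt : ∀ x ∈ closure G.Ω, x ≠ x₀ → u x < φ x)
    (hF : x₀ ∈ frontier G.Ω → G.F x₀ < u x₀) {g : Eucl n → Eucl n}
    (hg : ContinuousOn g (closure G.Ω)) (hgf : ∀ x ∈ G.Ω, g x = gradient G.f x)
    (hv₀ : gradient φ x₀ ≠ 0) :
    0 ≤ normalizedPOperator G.p (G.f x₀) (g x₀) (gradient φ x₀) (fderiv ℝ (gradient φ) x₀) := by
  by_contra! hneg
  set B := fderiv ℝ (gradient φ) x₀ with hB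
  set v₀ := gradient φ x₀ with hv₀_def
  set N₀ := normalizedPOperator G.p (G.f x₀) (g x₀) v₀ B with hN₀
  obtain ⟨D, hD, hDle⟩ := G.exists_gammaDenom_le
  have hp := G.p_add_pos
  have hvpos : 0 < ‖v₀‖ := norm_pos_iff.2 hv₀
  -- the quantitative decrease
  set κ := -N₀ / 2 / (2 * (G.p + n) * D) with hκ
  have hκpos : 0 < κ := div_pos (by linarith) (by positivity)
  obtain ⟨hdiff, hcontB⟩ := hφ.differentiableAt_gradient G hx₀
  obtain ⟨O, hO, hOs, hφO⟩ := id hφ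
  -- a ball in which the Hessian is almost constant
  obtain ⟨r₁, hr₁, hball⟩ : ∃ r > 0, ∀ z ∈ Metric.ball x₀ r, z ∈ O ∧
      ‖fderiv ℝ (gradient φ) z - B‖ ≤ κ / 2 := by
    have h1 : ∀ᶠ z in 𝓝 x₀, ‖fderiv ℝ (gradient φ) z - B‖ < κ / 2 := by
      have : Tendsto (fun z => ‖fderiv ℝ (gradient φ) z - B‖) (𝓝 x₀) (𝓝 0) :=
        tendsto_iff_norm_sub_tendsto_zero.1 hcontB
      exact this.eventually_lt_const (half_pos hκpos)
    obtain ⟨r, hr, h⟩ := Metric.eventually_nhds_iff_ball.1 (h1.and (hO.mem_nhds (hOs hx₀)))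
    exact ⟨r, hr, fun z hz => ⟨(h z hz).2, (h z hz).1.le⟩⟩
  -- a ball in which the operator is negative
  obtain ⟨r₂, hr₂, hop⟩ : ∃ r > 0, ∀ z ∈ G.Ω, z ∈ Metric.ball x₀ r →
      normalizedPOperator G.p (G.f z) (gradient G.f z) (gradient φ z) B < N₀ / 2 ∧
      ‖v₀‖ / 2 < ‖gradient φ z‖ := by
    have h1 : Tendsto (fun z => normalizedPOperator G.p (G.f z) (g z) (gradient φ z) B)
        (𝓝[G.Ω] x₀) (𝓝 N₀) :=
      tendsto_normalizedPOperator hv₀ ((G.f_continuousOn_closure x₀ hx₀).mono subset_closure)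
        ((hg x₀ hx₀).mono subset_closure) (hdiff.continuousAt.mono_left nhdsWithin_le_nhds)
        tendsto_const_nhds
    have h2 := h1.eventually_lt_const (show N₀ < N₀ / 2 by linarith)
    have h3 : ∀ᶠ z in 𝓝[G.Ω] x₀, ‖v₀‖ / 2 < ‖gradient φ z‖ :=
      (hdiff.continuousAt.norm.mono_left nhdsWithin_le_nhds).eventually_const_lt
        (half_lt_self hvpos)
    obtain ⟨r, hr, h⟩ := Metric.mem_nhdsWithin_iff.1 (h2.and h3)
    refine ⟨r, hr, fun z hz hzr => ?_⟩
    have := h ⟨hzr, hz⟩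
    rw [← hgf z hz]
    exact this
  set r := min (r₁ / 2) r₂ with hr
  have hrpos : 0 < r := lt_min (half_pos hr₁) hr₂
  -- the functions are well below the test function away from the touching point
  obtain ⟨η₁, hη₁, hstrip⟩ := exists_outerStrip_sub_le hφ fun x hx => by
    by_cases hxx : x = x₀
    · subst hxx
      rw [heq]
      exact hF hx
    · exact (hU.F_le hu hx).trans_lt (hlt x (frontier_subset_closure hx) hxx)
  obtain ⟨η₂, hη₂, hfar⟩ := hU.exists_sub_le hu hφ
    (G.isCompact_closure.diff Metric.isOpen_ball) Set.sdiff_subset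
    (K := closure G.Ω \ Metric.ball x₀ r) fun x hx => hlt x hx.1 fun h => hx.2 (by
      rw [h]; exact Metric.mem_ball_self hrpos)
  set η := min η₁ η₂ with hη
  have hηpos : 0 < η := lt_min hη₁ hη₂
  set C := ‖B‖ ^ 2 / (‖v₀‖ / 2) + ‖B‖ with hC
  have hC0 : 0 ≤ C := by positivity
  -- The Taylor error uses half of `κ * ε ^ 2`. The rest must beat `C * ε ^ 3` from the expansion
  -- and `ε ^ 3` from the almost maximum, hence `C + 1`.
  set ε₁ := min (min (min ε₀ η) r) (κ / (2 * (C + 1))) with hε₁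
  have hε₁pos : 0 < ε₁ := by
    have := hU.pos
    positivity
  obtain ⟨ν, hν, hφν⟩ : ∃ ν > 0, ∀ y, dist y x₀ < ν → φ y < φ x₀ + η / 4 := by
    have h1 := (hφ.continuousAt hx₀).eventually_lt_const (show φ x₀ < φ x₀ + η / 4 by linarith)
    exact Metric.eventually_nhds_iff.1 h1
  obtain ⟨ε, hε, hεlt, y₀, hy₀, hy₀d, hy₀U⟩ := hU.exists_gt hu hx₀
    (c := u x₀ - η / 4) (by linarith) (lt_min hε₁pos hν)
  have hεε₁ := hεlt.trans_le (min_le_left _ _)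
  have hεε₀ : ε < ε₀ := hεε₁.trans_le
    ((min_le_left _ _).trans ((min_le_left _ _).trans (min_le_left _ _)))
  have hεη : ε < η := hεε₁.trans_le
    ((min_le_left _ _).trans ((min_le_left _ _).trans (min_le_right _ _)))
  have hεr : ε < r := hεε₁.trans_le ((min_le_left _ _).trans (min_le_right _ _))
  have hεκ : ε < κ / (2 * (C + 1)) := hεε₁.trans_le (min_le_right _ _)
  have hε1 : ε ≤ 1 := hεε₀.le.trans hU.le_one
  have hV := hU.isDPPSolution ε hε hεε₀
  -- almost maximum point
  set Φ : Set ℝ := (fun y => U ε y - φ y) '' closure G.Ω with hΦ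
  have hΦb : BddAbove Φ := by
    have hc : ContinuousOn φ (closure G.Ω) := hφO.continuousOn.mono hOs
    obtain ⟨A, hA⟩ := G.isCompact_closure.exists_bound_of_continuousOn hc
    refine ⟨M + A, ?_⟩
    rintro _ ⟨y, hy, rfl⟩
    have h1 := (abs_le.1 (hV.bound y)).2
    have h2 := (abs_le.1 (hA y hy)).1
    show U ε y - φ y ≤ M + A
    linarith
  set m := sSup Φ with hm
  have hle : ∀ y ∈ closure G.Ω, U ε y ≤ φ y + m := fun y hy => by
    have : U ε y - φ y ≤ m := le_csSup hΦb ⟨y, hy, rfl⟩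
    linarith
  have hm_low : -(η / 2) < m := by
    have h1 := hle y₀ hy₀
    have h2 := hφν y₀ (hy₀d.trans_le (min_le_right _ _))
    linarith
  -- The value need not be continuous, so a maximum may not be attained; a defect below `ε ^ 3` is
  -- harmless. The second bound `-(η / 2)` keeps the point near `x₀` and out of the strip.
  obtain ⟨_, ⟨x, hx, rfl⟩, hxm⟩ := exists_lt_of_lt_csSup (s := Φ) ⟨_, y₀, hy₀, rfl⟩
    (max_lt (sub_lt_self m (pow_pos hε 3)) hm_low)
  obtain ⟨hxm1, hxm2⟩ := max_lt_iff.1 hxm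
  have hxball : x ∈ Metric.ball x₀ r := by
    by_contra hcon
    have := hfar ε hε (hεη.trans_le (min_le_right _ _)) x ⟨hx, hcon⟩
    have h2 := min_le_right η₁ η₂
    linarith
  have hstrip' : ∀ y ∈ G.outerStrip ε, U ε y ≤ φ y - η := fun y hy => by
    have h1 := hstrip ε (hεη.le.trans (min_le_left _ _)) y hy
    have h2 := min_le_left η₁ η₂
    rw [hV.eq_F y hy]
    linarith
  have hxΩ : x ∈ G.Ω := by
    rcases G.closure_subset_region hε hx with h | h
    · exact h
    · have := hstrip' x h
      linarith
  -- The comparison is needed on the strip as well, because a step from `x` may leave the closure of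
  -- `Ω`.
  have hleR : ∀ y ∈ G.region ε, U ε y ≤ φ y + m := fun y hy => by
    rcases hy with h | h
    · exact hle y (subset_closure h)
    · have := hstrip' y h
      linarith
  -- replace the test function by its Taylor polynomial
  obtain ⟨hop1, hop2⟩ := hop x hxΩ (Metric.ball_subset_ball (min_le_right _ _) hxball)
  have hxv : gradient φ x ≠ 0 := norm_pos_iff.1 (by linarith)
  have hr1 : r + r ≤ r₁ := by
    have := min_le_left (r₁ / 2) r₂
    linarith
  have hquad : ∀ y, dist y x ≤ ε → U ε y ≤ (m + φ x + κ / 2 * ε ^ 2) +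
      inner ℝ (gradient φ x) (y - x) + inner ℝ (B (y - x)) (y - x) / 2 := by
    intro y hy
    have hyr : y ∈ Metric.ball x₀ r₁ := by
      have h1 := dist_triangle y x x₀
      have h2 := Metric.mem_ball.1 hxball
      exact Metric.mem_ball.2 (by linarith)
    have h1 := hleR y (G.mem_region_of_dist_le hxΩ hy)
    have h2 := abs_taylor_two_le (φ := φ) (B := B) (w := κ / 2) (convex_ball x₀ r₁)
      (fun z hz => (hφO.contDiffAt (hO.mem_nhds (hball z hz).1)).differentiableAt (by norm_num))
      (fun z hz => ((hφO.gradient_of_isOpen hO).contDiffAt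
        (hO.mem_nhds (hball z hz).1)).differentiableAt (by norm_num))
      (fun z hz => (hball z hz).2) (x := x) (h := y - x)
      (Metric.ball_subset_ball (by linarith) hxball) (by simpa using hyr)
    rw [add_sub_cancel] at h2
    have h3 := (abs_le.1 h2).2
    have h4 : κ / 2 * ‖y - x‖ ^ 2 ≤ κ / 2 * ε ^ 2 := by
      rw [← dist_eq_norm]
      gcongr
    linarith
  have hfin := hV.le_of_le_quadratic hε hε1 hxΩ hxv hquad
  have hNle : normalizedPOperator G.p (G.f x) (gradient G.f x) (gradient φ x) B /
      (2 * (G.p + n) * G.gammaDenom x) ≤ -κ := by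
    have h1 := gammaDenom_pos hxΩ
    have h2 := hDle x hxΩ
    rw [div_le_iff₀ (by positivity)]
    have h3 : κ * (2 * (G.p + n) * G.gammaDenom x) ≤ κ * (2 * (G.p + n) * D) := by gcongr
    have h4 : κ * (2 * (G.p + n) * D) = -N₀ / 2 := by
      rw [hκ]
      field_simp
    linarith
  have hCle : ‖B‖ ^ 2 / ‖gradient φ x‖ + ‖B‖ ≤ C := by
    rw [hC]
    gcongr
  have hκC : ε * (C + 1) < κ / 2 := by
    rw [lt_div_iff₀ (by positivity)] at hεκ
    linarith
  have h1 : ε ^ 2 * (normalizedPOperator G.p (G.f x) (gradient G.f x) (gradient φ x) B /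
      (2 * (G.p + n) * G.gammaDenom x)) ≤ ε ^ 2 * -κ := by gcongr
  have h2 : ε ^ 3 * (‖B‖ ^ 2 / ‖gradient φ x‖ + ‖B‖) ≤ ε ^ 3 * C := by gcongr
  have h3 : ε ^ 2 * (ε * (C + 1)) < ε ^ 2 * (κ / 2) := by gcongr
  nlinarith

/-- The upper half-relaxed limit is a generalized subsolution. -/
theorem IsValueFamily.isGeneralizedSubsolution (hU : G.IsValueFamily ε₀ M U)
    (hu : G.IsUpperHalfRelaxedLimit u) : G.IsGeneralizedSubsolution u := by
  refine ⟨hu.upperSemicontinuousOn, fun φ hφ x₀ hx₀ heq hlt => ?_⟩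
  obtain ⟨g, hg, hgf⟩ := G.gradient_f_extends
  have key : (x₀ ∈ frontier G.Ω → G.F x₀ < u x₀) →
      0 ≤ pOperator G.p (G.f x₀) (g x₀) (gradient φ x₀) (fderiv ℝ (gradient φ) x₀) := by
    intro hF
    -- The degenerate case is trivial for the unnormalized operator, so no perturbation of the test
    -- function is needed.
    by_cases hv : gradient φ x₀ = 0
    · rw [hv, pOperator_zero G.two_lt_p]
    · rw [pOperator_eq_mul_normalized _ _ hv]
      exact mul_nonneg (by positivity)
        (hU.normalizedPOperator_nonneg hu hφ hx₀ heq hlt hF hg hgf hv)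
  constructor
  · intro hΩ
    have hnf : x₀ ∉ frontier G.Ω := fun h => by
      rw [G.isOpen.frontier_eq] at h
      exact h.2 hΩ
    have := key fun h => absurd h hnf
    rw [G.weightedPLaplacian_eq hΩ (hφ.differentiableAt_gradient G hx₀).1, ← hgf x₀ hΩ]
    linarith
  · intro hfr
    rw [min_le_iff]
    by_cases hF : G.F x₀ < u x₀
    · left
      have := key fun _ => hF
      rw [G.weightedPLaplacianBoundary_eq hφ hg hgf hx₀]
      linarith
    · right
      linarith

lemma IsTestFunction.neg (hφ : G.IsTestFunction φ) : G.neg.IsTestFunction fun x => -φ x :=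
  let ⟨O, h1, h2, h3⟩ := hφ
  ⟨O, h1, h2, h3.neg⟩

/-- Unlike the interior identity, this one uses that the limit from inside exists, which the test
function hypothesis guarantees. -/
lemma weightedPLaplacianBoundary_neg (hφ : G.IsTestFunction φ) {x : Eucl n}
    (hx : x ∈ closure G.Ω) : G.weightedPLaplacianBoundary (fun y => -φ y) x =
      -G.weightedPLaplacianBoundary φ x := by
  obtain ⟨g, hg, hgf⟩ := G.gradient_f_extends
  rw [weightedPLaplacianBoundary, funext (G.weightedPLaplacian_neg φ)]
  refine extendFrom_eq hx ?_
  rw [G.weightedPLaplacianBoundary_eq hφ hg hgf hx]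
  exact (G.tendsto_weightedPLaplacian hφ hg hgf hx).neg

/-- Subsolutions for `-F` are the negatives of supersolutions for `F`. -/
theorem IsGeneralizedSubsolution.neg (hu : G.neg.IsGeneralizedSubsolution u) :
    G.IsGeneralizedSupersolution fun x => -u x := by
  refine ⟨fun x hx => ?_, fun φ hφ x₀ hx₀ heq hlt => ?_⟩
  · intro c hc
    filter_upwards [hu.1 x hx (-c) (by linarith)] with y hy
    linarith
  · obtain ⟨h1, h2⟩ := hu.2 _ hφ.neg x₀ hx₀ (by rw [heq, neg_neg])
      fun x hx hne => by linarith [hlt x hx hne]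
    constructor
    · intro hΩ
      have h3 : -G.weightedPLaplacian (fun y => -φ y) x₀ ≤ 0 := h1 hΩ
      rw [G.weightedPLaplacian_neg] at h3
      linarith
    · intro hfr
      have h3 : min (-G.weightedPLaplacianBoundary (fun y => -φ y) x₀) (u x₀ - -G.F x₀) ≤ 0 :=
        h2 hfr
      rw [weightedPLaplacianBoundary_neg hφ hx₀] at h3
      rw [le_max_iff]
      rcases min_le_iff.1 h3 with h | h
      · left; linarith
      · right; linarith

end

end WeightedDirichletProblem

theorem theorem1p1 {n : ℕ} (G : WeightedDirichletProblem n) :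
    (∃ ε₀ : ℝ, 0 < ε₀ ∧ ∀ (ε : ℝ) (hε : 0 < ε), ε < ε₀ → G.IsWellPosed hε) ∧
    ∃ uUpper uLower : EuclideanSpace ℝ (Fin n) → ℝ,
      G.IsUpperHalfRelaxedLimit uUpper ∧ G.IsLowerHalfRelaxedLimit uLower ∧
      G.IsGeneralizedSubsolution uUpper ∧ G.IsGeneralizedSupersolution uLower := by
  obtain ⟨ε₀, M, U, hU, hwell⟩ := G.exists_isValueFamily
  obtain ⟨u, hu⟩ := hU.exists_isUpperHalfRelaxedLimit
  obtain ⟨w, hw⟩ := hU.neg.exists_isUpperHalfRelaxedLimit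
  exact ⟨⟨ε₀, hU.pos, hwell⟩, u, fun x => -w x, hu, hU.isLowerHalfRelaxedLimit_neg hw,
    hU.isGeneralizedSubsolution hu, (hU.neg.isGeneralizedSubsolution hw).neg⟩
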